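/- Let $\mathcal H$ be a complex Hilbert space (for instance $L^2(\Omega;\mathbb C)$), let $\langle f|F|g\rangle=\langle f,Fg\rangle$ with the inner product antilinear in the first argument, and let $H$ be a (possibly unbounded) self-adjoint operator on $\mathcal H$, i.e. $-iH$ generates a strongly continuous unitary group $(e^{-itH})_{t\in\mathbb R}$. Let $\mu,O$ be bounded self-adjoint operators on $\mathcal H$ with $O$ positive semi-definite, and let $\psi_0\in\mathcal H$, $T>0$, $\alpha>0$. For a control $\varepsilon\in L^2([0,T];\mathbb R)$, a solution on $[0,T]$ of $i\varphi'=(H-\varepsilon(t)\mu)\varphi$, $\varphi(t_0)=\varphi_0$, is a $\varphi\in C([0,T];\mathcal H)$ with $$\varphi(t)=e^{-i(t-t_0)H}\varphi_0+\int_{t_0}^t e^{-i(t-s)H}\,i\,\varepsilon(s)\mu\varphi(s)\,ds\qquad(t\in[0,T]).$$ The cost functional is $J(\varepsilon)=\langle\psi(T)|O|\psi(T)\rangle-\alpha\int_0^T\varepsilon(t)^2\,dt$, where $\psi$ is the solution with $\psi(0)=\psi_0$. Let $\delta,\eta\in[0,2]$ with $|(1-\delta)(1-\eta)|<1$. Starting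 from some $\varepsilon^0\in L^2([0,T];\mathbb R)$, let $(\varepsilon^k)_{k\ge0}$, $(\tilde\varepsilon^k)_{k\ge0}$ in $L^2([0,T];\mathbb R)$, with states $\psi^k$ and adjoint states $\chi^k$, satisfy the monotonic scheme: for all $k\ge 0$ and almost every $t\in[0,T]$ in the formulas for the controls, $$\begin{aligned} & i\partial_t\psi^k=(H-\varepsilon^k\mu)\psi^k,\quad \psi^k(0)=\psi_0;\qquad i\partial_t\chi^k=(H-\tilde\varepsilon^k\mu)\chi^k,\quad \chi^k(T)=O\psi^k(T);\\ & \tilde\varepsilon^k(t)=(1-\eta)\varepsilon^k(t)-\tfrac{\eta}{\alpha}\,\mathrm{Im}\langle\chi^k(t)|\mu|\psi^k(t)\rangle;\\ & \varepsilon^{k+1}(t)=(1-\delta)\tilde\varepsilon^{k}(t)-\tfrac{\delta}{\alpha}\,\mathrm{Im}\langle\chi^{k}(t)|\mu|\psi^{k+1}(t)\rangle . \end{aligned}$$ Let $k_0<k_1<\cdots$ be indices such that $(\varepsilon^{k_n})_n$ or $(\tilde\varepsilon^{k_n})_n$ converges weakly in $L^2([0,T];\mathbb R)$ to some $\varepsilon$.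 Then: 1. Both $\varepsilon^{k_n}\to\varepsilon$ and $\tilde\varepsilon^{k_n}\to\varepsilon$ strongly in $L^2([0,T];\mathbb R)$. 2. $\varepsilon$ is a critical point of $J$: $J$ is Fréchet differentiable at $\varepsilon$ with derivative $0$, and $\varepsilon$ solves the Euler–Lagrange system, i.e. the solutions $\psi,\chi$ of $i\partial_t\psi=(H-\varepsilon\mu)\psi$, $\psi(0)=\psi_0$, and $i\partial_t\chi=(H-\varepsilon\mu)\chi$, $\chi(T)=O\psi(T)$, exist and satisfy $\alpha\varepsilon(t)=-\mathrm{Im}\langle\chi(t)|\mu|\psi(t)\rangle$ for almost every $t\in[0,T]$. 3. If $\varepsilon^0$ is (almost everywhere equal to) a continuous function on $[0,T]$, then so are $\varepsilon$ and all $\varepsilon^k,\tilde\varepsilon^k$, and the two convergences in 1 hold in $C([0,T];\mathbb R)$, i.e. uniformly on $[0,T]$ for the continuous representatives. -/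

import Mathlib

open MeasureTheory Filter Topology Set

/-- The space `L²([0,T]; ℝ)` of controls. -/
abbrev ControlSpace (T : ℝ) : Type := Lp ℝ 2 ((volume : Measure ℝ).restrict (Icc (0 : ℝ) T))

/-- `U t = exp(-itH)`: the family `U` is a strongly continuous one-parameter unitary group whose
infinitesimal generator is `-iH`, domain included. (By Stone's theorem such a group, unique when it
exists, exists exactly when the possibly unbounded operator `H` is self-adjoint.) -/
structure IsSchrodingerGroup {E : Type*} [NormedAddCommGroup E] [InnerProductSpace ℂ E]
    (H : E →ₗ.[ℂ] E) (U : ℝ → E →L[ℂ] E) : Prop where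
  map_zero : U 0 = 1
  map_add : ∀ s t : ℝ, U (s + t) = U s * U t
  norm_map : ∀ (t : ℝ) (v : E), ‖U t v‖ = ‖v‖
  continuous : ∀ v : E, Continuous fun t : ℝ => U t v
  generator : ∀ v w : E,
    (v, w) ∈ H.graph ↔ HasDerivAt (fun t : ℝ => U t v) (-(Complex.I • w)) 0

/-- `φ ∈ C([0,T]; E)` is the (mild) solution on `[0,T]` of `i φ' = (H - ε(t) μ) φ`, `φ(t₀) = φ₀`,
where `U t = exp(-itH)`:
`φ(t) = exp(-i(t-t₀)H) φ₀ + ∫_{t₀}^t exp(-i(t-s)H) i ε(s) μ φ(s) ds`.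
It is used with `t₀ = 0` for the state and with `t₀ = T` for the adjoint state. -/
def IsMildSolution {E : Type*} [NormedAddCommGroup E] [InnerProductSpace ℂ E]
    (U : ℝ → E →L[ℂ] E) (μ : E →L[ℂ] E) (T : ℝ) (ε : ControlSpace T)
    (t₀ : ℝ) (φ₀ : E) (φ : ℝ → E) : Prop :=
  ContinuousOn φ (Icc 0 T) ∧
    ∀ t ∈ Icc (0 : ℝ) T,
      φ t = U (t - t₀) φ₀ + ∫ s in t₀..t, (Complex.I * (ε s : ℂ)) • U (t - s) (μ (φ s))

/-- The state associated with the control `ε` and the initial datum `ψ₀` (only its values on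
`[0,T]` matter). -/
noncomputable def controlledState {E : Type*} [NormedAddCommGroup E] [InnerProductSpace ℂ E]
    (U : ℝ → E →L[ℂ] E) (μ : E →L[ℂ] E) (T : ℝ) (ψ₀ : E) (ε : ControlSpace T) : ℝ → E :=
  Classical.epsilon fun ψ : ℝ → E => IsMildSolution U μ T ε 0 ψ₀ ψ

/-- `J(ε) = ⟨ψ(T)|O|ψ(T)⟩ - α ∫₀ᵀ ε(t)² dt`, with `ψ` the state associated with `ε`. -/
noncomputable def costFunctional {E : Type*} [NormedAddCommGroup E] [InnerProductSpace ℂ E]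
    (U : ℝ → E →L[ℂ] E) (μ O : E →L[ℂ] E) (T α : ℝ) (ψ₀ : E) (ε : ControlSpace T) : ℝ :=
  (inner ℂ (controlledState U μ T ψ₀ ε T) (O (controlledState U μ T ψ₀ ε T))).re
    - α * ∫ t in (0 : ℝ)..T, (ε t) ^ 2

/-- The Euler–Lagrange system: with the state `ψ` and the adjoint state `χ` associated with `ε`,
`α ε(t) = - Im ⟨χ(t)|μ|ψ(t)⟩` for almost every `t ∈ [0,T]`. -/
def SolvesEulerLagrange {E : Type*} [NormedAddCommGroup E] [InnerProductSpace ℂ E]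
    (U : ℝ → E →L[ℂ] E) (μ O : E →L[ℂ] E) (T α : ℝ) (ψ₀ : E) (ε : ControlSpace T) : Prop :=
  ∃ ψ χ : ℝ → E,
    IsMildSolution U μ T ε 0 ψ₀ ψ ∧
    IsMildSolution U μ T ε T (O (ψ T)) χ ∧
    ∀ᵐ t ∂((volume : Measure ℝ).restrict (Icc (0 : ℝ) T)),
      α * ε t = -(inner ℂ (χ t) (μ (ψ t))).im

/-- The sequences of controls `ε^k`, `ε'^k` (the latter is usually written with a tilde), of states
`ψ^k` and of adjoint states `χ^k` are produced by the monotonic scheme with parameters `δ`, `η`,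
started from the initial guess `ε^0`. -/
structure IsMonotonicScheme {E : Type*} [NormedAddCommGroup E] [InnerProductSpace ℂ E]
    (U : ℝ → E →L[ℂ] E) (μ O : E →L[ℂ] E) (T α δ η : ℝ) (ψ₀ : E)
    (ε ε' : ℕ → ControlSpace T) (ψ χ : ℕ → ℝ → E) : Prop where
  state : ∀ k, IsMildSolution U μ T (ε k) 0 ψ₀ (ψ k)
  control : ∀ k, ∀ᵐ t ∂((volume : Measure ℝ).restrict (Icc (0 : ℝ) T)),
    ε (k + 1) t = (1 - δ) * ε' k t - δ / α * (inner ℂ (χ k t) (μ (ψ (k + 1) t))).im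
  adjoint : ∀ k, IsMildSolution U μ T (ε' k) T (O (ψ k T)) (χ k)
  control' : ∀ k, ∀ᵐ t ∂((volume : Measure ℝ).restrict (Icc (0 : ℝ) T)),
    ε' k t = (1 - η) * ε k t - η / α * (inner ℂ (χ k t) (μ (ψ k t))).im

/-- Weak convergence of a sequence in `L²([0,T]; ℝ)`. -/
def WeaklyTendsto {T : ℝ} (x : ℕ → ControlSpace T) (e : ControlSpace T) : Prop :=
  ∀ g : ControlSpace T, Tendsto (fun n => inner ℝ g (x n)) atTop (𝓝 (inner ℝ g e))

/-- `f` is a representative of `e ∈ L²([0,T]; ℝ)` that is continuous on `[0,T]`. -/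
def IsContinuousRep {T : ℝ} (e : ControlSpace T) (f : ℝ → ℝ) : Prop :=
  ContinuousOn f (Icc 0 T) ∧ e =ᵐ[(volume : Measure ℝ).restrict (Icc (0 : ℝ) T)] f

/-! ### Integration by parts for indefinite integrals of integrable functions -/

section IntegralCalculus

variable {F : Type*} [NormedAddCommGroup F] [InnerProductSpace ℝ F]

/-! In the interaction picture `X(t) = U(-t) ψ(t)` the unbounded `H` disappears: the equation
becomes `X' = a(t) C(t) X` with `C(t) = i U(-t) μ U(t)`, which is bounded, strongly continuous and
skew for the real inner product `Re ⟨·,·⟩`. Since `-Im ⟨χ|μ|ψ⟩ = ⟨Y, C X⟩`, both control updates are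
relaxations towards a feedback law: `b - a = η (p - a)` and `a⁺ - b = δ (q - b)`. The final cost is
given by the positive operator `Q = U(-T) O U(T)`.

Monotonicity. Duality between state and adjoint (`IsEvolution.inner_apply_sub`) and a completed
square show that one sweep raises `J` by exactly `⟨ΔX(T), Q ΔX(T)⟩ + α (2/δ - 1) ‖a⁺ - b‖² + α (2/η
- 1) ‖b - a‖²`. All terms are nonnegative and `J` is bounded above, so the controls stay bounded and
every term tends to zero. The condition on `δ, η` puts one of them in the open interval `(0, 2)`, so
one of the two control differences tends to zero; Gronwall's inequality in `L²` gives the other. The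
residual `P(a k) - a k` also vanishes, where `P(a)` is the feedback law built from the state and
adjoint state both driven by `a` (`IsFeedbackScheme.tendsto_sub`).

Compactness. Trajectories depend continuously on the control from the weak topology to pointwise
norm convergence (`IsEvolution.tendsto_of_weaklyTendsto`). Hence `P(a (k n))` converges strongly to
`P(e)`, so does `a (k n)`, and uniqueness of weak limits gives `e = P(e)`, the Euler–Lagrange
system. At such an `e` the exact increment formula has no first-order term, so `J(c) - J(e) = O(‖c -
e‖²)`.

Uniform convergence. The pointwise error between `a k` and `P(a k)` is multiplied at each sweep by
`(1 - δ)(1 - η)`, up to a perturbation that tends to zero uniformly in `t`, so it tends to zero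
uniformly; and `P(a (k n))` converges uniformly to `P(e)`. -/

theorem AbsolutelyContinuousOnInterval.of_dist_le {X : Type*} [PseudoMetricSpace X] {f : ℝ → X}
    {g : ℝ → ℝ} {a b : ℝ} (hg : AbsolutelyContinuousOnInterval g a b)
    (h : ∀ s ∈ uIcc a b, ∀ t ∈ uIcc a b, dist (f s) (f t) ≤ dist (g s) (g t)) :
    AbsolutelyContinuousOnInterval f a b := by
  refine squeeze_zero' (Eventually.of_forall fun E => Finset.sum_nonneg fun _ _ => dist_nonneg)
    ?_ hg
  have : AbsolutelyContinuousOnInterval.disjWithin a b ∈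
      AbsolutelyContinuousOnInterval.totalLengthFilter ⊓
        𝓟 (AbsolutelyContinuousOnInterval.disjWithin a b) := mem_inf_of_right (mem_principal_self _)
  filter_upwards [this] with E hE
  exact Finset.sum_le_sum fun i hi => h _ (hE.1 i hi).1 _ (hE.1 i hi).2

theorem continuousOn_of_eq_integral {T t₀ : ℝ} (hT : 0 ≤ T) (ht₀ : t₀ ∈ Icc 0 T) {X u : ℝ → F}
    {x₀ : F} (hu : IntervalIntegrable u volume 0 T)
    (hX : ∀ t ∈ Icc 0 T, X t = x₀ + ∫ s in t₀..t, u s) : ContinuousOn X (Icc 0 T) := by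
  have h := intervalIntegral.continuousOn_primitive_interval' hu (by rwa [uIcc_of_le hT])
  rw [uIcc_of_le hT] at h
  exact (continuousOn_const.add h).congr hX

theorem IntervalIntegrable.mono_Icc {G : Type*} [NormedAddCommGroup G] {T s t : ℝ} (hT : 0 ≤ T)
    {u : ℝ → G} (hu : IntervalIntegrable u volume 0 T) (hs : s ∈ Icc 0 T) (ht : t ∈ Icc 0 T) :
    IntervalIntegrable u volume s t :=
  hu.mono_set (by rw [uIcc_of_le hT]; exact uIcc_subset_Icc hs ht)

theorem sub_eq_integral_of_eq_integral {T t₀ : ℝ} (hT : 0 ≤ T) (ht₀ : t₀ ∈ Icc 0 T) {X u : ℝ → F}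
    {x₀ : F} (hu : IntervalIntegrable u volume 0 T)
    (hX : ∀ t ∈ Icc 0 T, X t = x₀ + ∫ s in t₀..t, u s) {s t : ℝ} (hs : s ∈ Icc 0 T)
    (ht : t ∈ Icc 0 T) : X t - X s = ∫ r in s..t, u r := by
  rw [hX t ht, hX s hs, add_sub_add_left_eq_sub,
    intervalIntegral.integral_interval_sub_left (hu.mono_Icc hT ht₀ ht) (hu.mono_Icc hT ht₀ hs)]

theorem intervalIntegrable_inner_of_continuousOn {T : ℝ} (hT : 0 ≤ T) {X u : ℝ → F}
    (hX : ContinuousOn X (Icc 0 T)) (hu : IntervalIntegrable u volume 0 T) :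
    IntervalIntegrable (fun s => inner ℝ (X s) (u s)) volume 0 T := by
  obtain ⟨K, hK⟩ := isCompact_Icc.exists_bound_of_continuousOn hX
  rw [intervalIntegrable_iff_integrableOn_Icc_of_le hT] at hu ⊢
  refine Integrable.mono' (hu.norm.const_mul K)
    ((hX.aestronglyMeasurable measurableSet_Icc).inner hu.aestronglyMeasurable) ?_
  filter_upwards [ae_restrict_mem measurableSet_Icc] with s hs
  exact (norm_inner_le_norm _ _).trans (mul_le_mul_of_nonneg_right (hK s hs) (norm_nonneg _))

variable [CompleteSpace F]

/-- Integration by parts for the inner product of two indefinite integrals. -/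
theorem inner_sub_inner_eq_integral {T t₀ t₁ : ℝ} (hT : 0 ≤ T) (ht₀ : t₀ ∈ Icc 0 T)
    (ht₁ : t₁ ∈ Icc 0 T) {X Y u v : ℝ → F} {x₀ y₀ : F} (hu : IntervalIntegrable u volume 0 T)
    (hv : IntervalIntegrable v volume 0 T) (hX : ∀ t ∈ Icc 0 T, X t = x₀ + ∫ s in t₀..t, u s)
    (hY : ∀ t ∈ Icc 0 T, Y t = y₀ + ∫ s in t₁..t, v s) {s t : ℝ} (hs : s ∈ Icc 0 T)
    (ht : t ∈ Icc 0 T) :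
    (inner ℝ (X t) (Y t) : ℝ) - inner ℝ (X s) (Y s)
      = ∫ r in s..t, (inner ℝ (u r) (Y r) + inner ℝ (X r) (v r)) := by
  have h0 : (0 : ℝ) ∈ Icc 0 T := ⟨le_rfl, hT⟩
  have hI : uIcc 0 T = Icc 0 T := uIcc_of_le hT
  have hXc := continuousOn_of_eq_integral hT ht₀ hu hX
  have hYc := continuousOn_of_eq_integral hT ht₁ hv hY
  obtain ⟨K, hK⟩ := isCompact_Icc.exists_bound_of_continuousOn hXc
  obtain ⟨L, hL⟩ := isCompact_Icc.exists_bound_of_continuousOn hYc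
  have hK0 : 0 ≤ K := (norm_nonneg _).trans (hK 0 h0)
  have hL0 : 0 ≤ L := (norm_nonneg _).trans (hL 0 h0)
  set w : ℝ → ℝ := fun r => inner ℝ (u r) (Y r) + inner ℝ (X r) (v r) with hw
  have hwi : IntervalIntegrable w volume 0 T := by
    refine IntervalIntegrable.add ?_ (intervalIntegrable_inner_of_continuousOn hT hXc hv)
    simpa only [real_inner_comm] using intervalIntegrable_inner_of_continuousOn hT hYc hu
  -- `W` is the defect of the claimed identity. It is constant because it is absolutely continuous,
  -- its increments being dominated by those of the primitive of `m`, and has zero derivative almost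
  -- everywhere.
  set W : ℝ → ℝ := fun t => inner ℝ (X t) (Y t) - ∫ r in (0 : ℝ)..t, w r with hW
  set m : ℝ → ℝ := fun r => L * ‖u r‖ + K * ‖v r‖ + |w r| with hm
  have hmi : IntervalIntegrable m volume 0 T :=
    ((hu.norm.const_mul L).add (hv.norm.const_mul K)).add hwi.abs
  have hac : AbsolutelyContinuousOnInterval W 0 T := by
    refine (hmi.absolutelyContinuousOnInterval_intervalIntegral (c := 0) (by simp)).of_dist_le ?_
    rw [hI]
    have key : ∀ s ∈ Icc 0 T, ∀ t ∈ Icc 0 T, s ≤ t →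
        dist (W s) (W t) ≤ dist (∫ r in (0 : ℝ)..s, m r) (∫ r in (0 : ℝ)..t, m r) := by
      intro s hs t ht hst
      have hmst := hmi.mono_Icc hT hs ht
      have hust := hu.mono_Icc hT hs ht
      have hvst := hv.mono_Icc hT hs ht
      have hwst := hwi.mono_Icc hT hs ht
      have e1 : W t - W s = inner ℝ (X t - X s) (Y t) + inner ℝ (X s) (Y t - Y s)
          - ∫ r in s..t, w r := by
        rw [← intervalIntegral.integral_interval_sub_left (hwi.mono_Icc hT h0 ht)
          (hwi.mono_Icc hT h0 hs)]
        simp only [hW, inner_sub_left, inner_sub_right]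
        ring
      have e2 : ‖X t - X s‖ ≤ ∫ r in s..t, ‖u r‖ := by
        rw [sub_eq_integral_of_eq_integral hT ht₀ hu hX hs ht]
        exact intervalIntegral.norm_integral_le_integral_norm hst
      have e3 : ‖Y t - Y s‖ ≤ ∫ r in s..t, ‖v r‖ := by
        rw [sub_eq_integral_of_eq_integral hT ht₁ hv hY hs ht]
        exact intervalIntegral.norm_integral_le_integral_norm hst
      have e4 : |∫ r in s..t, w r| ≤ ∫ r in s..t, |w r| :=
        intervalIntegral.abs_integral_le_integral_abs hst
      have e5 : ∫ r in s..t, m r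
          = L * (∫ r in s..t, ‖u r‖) + K * (∫ r in s..t, ‖v r‖) + ∫ r in s..t, |w r| := by
        rw [hm, intervalIntegral.integral_add
          ((hust.norm.const_mul L).add (hvst.norm.const_mul K)) hwst.abs,
          intervalIntegral.integral_add (hust.norm.const_mul L) (hvst.norm.const_mul K),
          intervalIntegral.integral_const_mul, intervalIntegral.integral_const_mul]
      have e6 : |(inner ℝ (X t - X s) (Y t) : ℝ)| ≤ L * ∫ r in s..t, ‖u r‖ :=
        (abs_real_inner_le_norm _ _).trans (by
          rw [mul_comm]; exact mul_le_mul (hL t ht) e2 (norm_nonneg _) hL0)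
      have e7 : |(inner ℝ (X s) (Y t - Y s) : ℝ)| ≤ K * ∫ r in s..t, ‖v r‖ :=
        (abs_real_inner_le_norm _ _).trans (mul_le_mul (hK s hs) e3 (norm_nonneg _) hK0)
      rw [dist_comm, Real.dist_eq, e1, dist_comm, Real.dist_eq,
        intervalIntegral.integral_interval_sub_left (hmi.mono_Icc hT h0 ht)
          (hmi.mono_Icc hT h0 hs), e5]
      refine le_trans ?_ (le_abs_self _)
      rw [abs_le] at *
      constructor <;> linarith [e4.1, e4.2, e6.1, e6.2, e7.1, e7.2]
    intro s hs t ht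
    rcases le_total s t with hst | hst
    · exact key s hs t ht hst
    · rw [dist_comm, dist_comm (∫ r in (0 : ℝ)..s, m r)]
      exact key t ht s hs hst
  -- Lebesgue differentiation. The endpoints are discarded because the integral formulas for `X` and
  -- `Y` hold only inside `[0,T]`, which must be a neighbourhood of `x`.
  have hder : ∀ᵐ x, x ∈ uIcc 0 T → HasDerivAt W 0 x := by
    have n0 : ∀ᵐ x : ℝ, x ≠ 0 := by simp [ae_iff, measure_singleton]
    have nT : ∀ᵐ x : ℝ, x ≠ T := by simp [ae_iff, measure_singleton]
    filter_upwards [hu.ae_hasDerivAt_integral, hv.ae_hasDerivAt_integral,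
      hwi.ae_hasDerivAt_integral, n0, nT] with x h1 h2 h3 hx0 hxT hx
    have hx' := hx
    rw [hI] at hx'
    have hnhds : Icc 0 T ∈ 𝓝 x :=
      Icc_mem_nhds (lt_of_le_of_ne hx'.1 (Ne.symm hx0)) (lt_of_le_of_ne hx'.2 hxT)
    have d1 : HasDerivAt X (u x) x := by
      refine ((h1 hx t₀ (hI ▸ ht₀)).const_add x₀).congr_of_eventuallyEq ?_
      filter_upwards [hnhds] with y hy using hX y hy
    have d2 : HasDerivAt Y (v x) x := by
      refine ((h2 hx t₁ (hI ▸ ht₁)).const_add y₀).congr_of_eventuallyEq ?_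
      filter_upwards [hnhds] with y hy using hY y hy
    have d3 := (d1.inner ℝ d2).sub (h3 hx 0 (by simp))
    have hz : (inner ℝ (X x) (v x) : ℝ) + inner ℝ (u x) (Y x) - w x = 0 := by
      rw [hw]; ring
    rwa [hz] at d3
  obtain ⟨c, hc⟩ := hac.const_of_ae_hasDerivAt_zero hder
  rw [hI] at hc
  have := (hc t ht).trans (hc s hs).symm
  rw [← intervalIntegral.integral_interval_sub_left (hwi.mono_Icc hT h0 ht)
          (hwi.mono_Icc hT h0 hs)]
  simp only [hW] at this
  linarith

end IntegralCalculus

/-! ### Estimates in the control space, exponential weights and Gronwall's inequality -/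

section Control

theorem memLp_two_of_continuousOn {T : ℝ} {f : ℝ → ℝ} (hf : ContinuousOn f (Icc 0 T)) :
    MemLp f 2 ((volume : Measure ℝ).restrict (Icc (0 : ℝ) T)) := by
  obtain ⟨K, hK⟩ := isCompact_Icc.exists_bound_of_continuousOn hf
  exact MemLp.of_bound (hf.aestronglyMeasurable measurableSet_Icc) K
    ((ae_restrict_mem measurableSet_Icc).mono hK)

open Classical in
/-- The class in `L²([0,T]; ℝ)` of a square-integrable function. -/
noncomputable def toControl (T : ℝ) (f : ℝ → ℝ) : ControlSpace T :=
  if h : MemLp f 2 ((volume : Measure ℝ).restrict (Icc (0 : ℝ) T)) then h.toLp f else 0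

theorem toControl_ae {T : ℝ} {f : ℝ → ℝ} (hf : ContinuousOn f (Icc 0 T)) :
    toControl T f =ᵐ[(volume : Measure ℝ).restrict (Icc (0 : ℝ) T)] f := by
  have h := memLp_two_of_continuousOn hf
  rw [toControl, dif_pos h]
  exact h.coeFn_toLp

namespace ControlSpace

variable {T : ℝ}

theorem inner_eq (a b : ControlSpace T) : (inner ℝ a b : ℝ) = ∫ t in Icc 0 T, a t * b t := by
  rw [L2.inner_def]
  simp [mul_comm]

theorem norm_sq_eq (a : ControlSpace T) : ‖a‖ ^ 2 = ∫ t in Icc 0 T, a t ^ 2 := by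
  rw [← real_inner_self_eq_norm_sq, inner_eq]
  simp [sq]

theorem norm_toControl_le (hT : 0 ≤ T) {f : ℝ → ℝ} (hf : ContinuousOn f (Icc 0 T)) {r : ℝ}
    (hr : 0 ≤ r) (h : ∀ t ∈ Icc 0 T, |f t| ≤ r) : ‖toControl T f‖ ≤ r * √T := by
  refine abs_le_of_sq_le_sq' ?_ (by positivity) |>.2
  rw [norm_sq_eq, mul_pow, Real.sq_sqrt hT]
  have e : ∫ t in Icc 0 T, (toControl T f t) ^ 2 ≤ ∫ t in Icc 0 T, r ^ 2 := by
    refine integral_mono_ae (Lp.memLp _).integrable_sq (integrable_const _) ?_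
    filter_upwards [toControl_ae hf, ae_restrict_mem measurableSet_Icc] with t h1 h2
    rw [h1]
    exact sq_le_sq' (abs_le.1 (h t h2)).1 (abs_le.1 (h t h2)).2
  refine e.trans (le_of_eq ?_)
  simp [hT, mul_comm]

theorem norm_le_add (hT : 0 ≤ T) {u v : ControlSpace T} {r : ℝ} (hr : 0 ≤ r)
    (h : ∀ᵐ t ∂((volume : Measure ℝ).restrict (Icc (0 : ℝ) T)), |u t| ≤ |v t| + r) :
    ‖u‖ ≤ ‖v‖ + r * √T := by
  have hc : ContinuousOn (fun _ : ℝ => r) (Icc 0 T) := continuousOn_const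
  have h1 : ‖u‖ ≤ ‖|v| + toControl T fun _ => r‖ := by
    refine Lp.norm_le_norm_of_ae_le ?_
    filter_upwards [h, toControl_ae hc, Lp.coeFn_abs v,
      Lp.coeFn_add |v| (toControl T fun _ => r)] with t h1 h2 h3 h4
    rw [h4, Pi.add_apply, h2, h3, Real.norm_eq_abs]
    exact h1.trans (le_abs_self _)
  refine h1.trans ((norm_add_le _ _).trans ?_)
  rw [norm_abs_eq_norm]
  gcongr
  exact norm_toControl_le hT hc hr fun t _ => (abs_of_nonneg hr).le

theorem intervalIntegrable (hT : 0 ≤ T) (a : ControlSpace T) :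
    IntervalIntegrable a volume 0 T := by
  rw [intervalIntegrable_iff_integrableOn_Icc_of_le hT]
  exact (Lp.memLp a).integrable one_le_two

theorem setIntegral_mul_abs_le {f : ℝ → ℝ} (hf : ContinuousOn f (Icc 0 T)) (a : ControlSpace T) :
    ∫ s in Icc 0 T, f s * |a s| ≤ ‖toControl T f‖ * ‖a‖ := by
  have e : ∫ s in Icc 0 T, f s * |a s| = inner ℝ (toControl T f) |a| := by
    rw [inner_eq]
    refine integral_congr_ae ?_
    filter_upwards [toControl_ae hf, Lp.coeFn_abs a] with t h1 h2
    rw [h1, h2]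
  rw [e, ← norm_abs_eq_norm a]
  exact real_inner_le_norm _ _

theorem integrableOn_mul_abs {f : ℝ → ℝ} (hf : ContinuousOn f (Icc 0 T)) (a : ControlSpace T) :
    IntegrableOn (fun s => f s * |a s|) (Icc 0 T) :=
  (memLp_two_of_continuousOn hf).integrable_mul (Lp.memLp a).abs

theorem abs_integral_le_setIntegral {g : ℝ → ℝ} (hg : IntegrableOn g (Icc 0 T))
    (hg0 : ∀ s, 0 ≤ g s) {t₀ t : ℝ} (ht₀ : t₀ ∈ Icc 0 T) (ht : t ∈ Icc 0 T) :
    |∫ s in t₀..t, g s| ≤ ∫ s in Icc 0 T, g s := by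
  rw [intervalIntegral.abs_intervalIntegral_eq,
    abs_of_nonneg (integral_nonneg fun s => hg0 s)]
  exact setIntegral_mono_set hg (Eventually.of_forall hg0)
    (LE.le.eventuallyLE (uIoc_subset_uIcc.trans (uIcc_subset_Icc ht₀ ht)))

theorem abs_integral_mul_abs_le {f : ℝ → ℝ} (hf : ContinuousOn f (Icc 0 T)) (hf0 : ∀ s, 0 ≤ f s)
    (a : ControlSpace T) {t₀ t : ℝ} (ht₀ : t₀ ∈ Icc 0 T) (ht : t ∈ Icc 0 T) :
    |(∫ s in t₀..t, f s * |a s|)| ≤ ‖toControl T f‖ * ‖a‖ :=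
  (abs_integral_le_setIntegral (integrableOn_mul_abs hf a)
    (fun s => mul_nonneg (hf0 s) (abs_nonneg _)) ht₀ ht).trans (setIntegral_mul_abs_le hf a)

theorem abs_integral_abs_le (hT : 0 ≤ T) (a : ControlSpace T) {t₀ t : ℝ} (ht₀ : t₀ ∈ Icc 0 T)
    (ht : t ∈ Icc 0 T) : |(∫ s in t₀..t, |a s|)| ≤ √T * ‖a‖ := by
  have hc : ContinuousOn (fun _ : ℝ => (1 : ℝ)) (Icc 0 T) := continuousOn_const
  have h := abs_integral_mul_abs_le hc (fun _ => zero_le_one) a ht₀ ht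
  simp only [one_mul] at h
  refine h.trans (mul_le_mul_of_nonneg_right ?_ (norm_nonneg _))
  simpa using norm_toControl_le hT hc zero_le_one fun t _ => (abs_one).le

theorem integral_abs_zero {t₀ t : ℝ} (ht₀ : t₀ ∈ Icc 0 T) (ht : t ∈ Icc 0 T) :
    ∫ s in t₀..t, |(0 : ControlSpace T) s| = 0 := by
  rw [intervalIntegral.integral_congr_ae (g := fun _ => 0)]
  · simp
  · filter_upwards [(ae_restrict_iff' measurableSet_Icc).1
      (Lp.coeFn_zero ℝ 2 ((volume : Measure ℝ).restrict (Icc (0 : ℝ) T)))] with s h1 h2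
    rw [h1 (uIcc_subset_Icc ht₀ ht (uIoc_subset_uIcc h2))]
    simp

/-- The square of the kernel has integral `1/l` over the whole line. Controls are only square
integrable, so it is this `L²` decay in `l` that makes weighted Volterra operators small. -/
theorem norm_toControl_exp_le {l : ℝ} (hl : 0 < l) (t : ℝ) :
    ‖toControl T fun s => Real.exp (-l * |t - s|)‖ ≤ (√l)⁻¹ := by
  have hc : ContinuousOn (fun s => Real.exp (-l * |t - s|)) (Icc 0 T) := by fun_prop
  have hI : ∫ s : ℝ, Real.exp (-(2 * l) * |t - s|) = l⁻¹ := by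
    rw [integral_sub_left_eq_self (fun x => Real.exp (-(2 * l) * |x|)) volume t,
      integral_comp_abs (f := fun x => Real.exp (-(2 * l) * x)),
      integral_exp_mul_Ioi (by linarith)]
    simp; field_simp
  -- A function that is not integrable has integral `0` by convention, so a nonzero value proves
  -- integrability.
  have hi : Integrable fun s : ℝ => Real.exp (-(2 * l) * |t - s|) :=
    Integrable.of_integral_ne_zero (by rw [hI]; positivity)
  refine abs_le_of_sq_le_sq' ?_ (by positivity) |>.2
  rw [norm_sq_eq, inv_pow, Real.sq_sqrt hl.le, ← hI]
  refine le_trans (le_of_eq ?_)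
    (setIntegral_le_integral (s := Icc 0 T) hi (Eventually.of_forall fun s => (Real.exp_pos _).le))
  refine integral_congr_ae ?_
  filter_upwards [toControl_ae hc] with s hs
  rw [hs, sq, ← Real.exp_add]
  ring_nf

theorem abs_integral_exp_mul_abs_le {l : ℝ} (hl : 0 < l) (a : ControlSpace T) {t₀ t : ℝ}
    (ht₀ : t₀ ∈ Icc 0 T) (ht : t ∈ Icc 0 T) :
    |(∫ s in t₀..t, Real.exp (-l * |t - s|) * |a s|)| ≤ (√l)⁻¹ * ‖a‖ :=
  (abs_integral_mul_abs_le (by fun_prop) (fun _ => (Real.exp_pos _).le) a ht₀ ht).trans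
    (mul_le_mul_of_nonneg_right (norm_toControl_exp_le hl t) (norm_nonneg _))

theorem abs_sub_eq_of_mem_uIoc {t₀ s t : ℝ} (hs : s ∈ uIoc t₀ t) :
    |s - t₀| - |t - t₀| = -|t - s| := by
  rcases mem_uIoc.1 hs with ⟨h1, h2⟩ | ⟨h1, h2⟩
  · rw [abs_of_pos (by linarith), abs_of_pos (by linarith), abs_of_nonneg (by linarith)]; ring
  · rw [abs_of_nonpos (by linarith), abs_of_neg (by linarith), abs_of_neg (by linarith)]; ring

/-- Weighted form of `abs_integral_exp_mul_abs_le`. -/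
theorem exp_mul_abs_integral_le {l : ℝ} (hl : 0 < l) (a : ControlSpace T) {t₀ t : ℝ}
    (ht₀ : t₀ ∈ Icc 0 T) (ht : t ∈ Icc 0 T) :
    Real.exp (-l * |t - t₀|) * |(∫ s in t₀..t, Real.exp (l * |s - t₀|) * |a s|)|
      ≤ (√l)⁻¹ * ‖a‖ := by
  refine le_trans (le_of_eq ?_) (abs_integral_exp_mul_abs_le hl a ht₀ ht)
  rw [← abs_of_pos (Real.exp_pos (-l * |t - t₀|)), ← abs_mul,
    ← intervalIntegral.integral_const_mul]
  congr 1
  refine intervalIntegral.integral_congr_ae (Eventually.of_forall fun s hs => ?_)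
  rw [← mul_assoc, ← Real.exp_add]
  congr 2
  linear_combination l * abs_sub_eq_of_mem_uIoc hs

/-- Gronwall's inequality in `L²`. -/
theorem exists_gronwall (hT : 0 ≤ T) {κ : ℝ} (hκ : 0 ≤ κ) :
    ∃ K, ∀ t₀ ∈ Icc 0 T, ∀ d r : ControlSpace T,
      (∀ᵐ t ∂((volume : Measure ℝ).restrict (Icc (0 : ℝ) T)),
        |d t| ≤ |r t| + κ * |(∫ s in t₀..t, |d s|)|) → ‖d‖ ≤ K * ‖r‖ := by
  -- The weight makes the Volterra term at most half of the weighted norm, so that it can be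
  -- absorbed on the left; the `+ 1` keeps `l` positive when `κ * √T = 0`. Since `|t - t₀| ≤ T`,
  -- removing the weight costs `exp (l * T)` uniformly in `t₀`.
  set l : ℝ := (2 * (κ * √T + 1)) ^ 2 with hl
  have hκT : 0 ≤ κ * √T := by positivity
  have hl0 : 0 < l := by positivity
  have hsl : √l = 2 * (κ * √T + 1) := Real.sqrt_sq (by positivity)
  refine ⟨Real.exp (l * T) * 2, fun t₀ ht₀ d r h => ?_⟩
  have hm : MemLp (fun s => Real.exp (-l * |s - t₀|) * |d s|) 2
      ((volume : Measure ℝ).restrict (Icc (0 : ℝ) T)) := by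
    refine (Lp.memLp d).of_le (((by fun_prop : Continuous fun s : ℝ =>
      Real.exp (-l * |s - t₀|)).aestronglyMeasurable).mul (Lp.memLp d).abs.aestronglyMeasurable)
      (Eventually.of_forall fun s => ?_)
    rw [norm_mul, Real.norm_eq_abs, Real.norm_eq_abs, abs_abs, abs_of_pos (Real.exp_pos _)]
    refine mul_le_of_le_one_left (abs_nonneg _) (Real.exp_le_one_iff.2 ?_)
    nlinarith [abs_nonneg (s - t₀)]
  set w : ControlSpace T := hm.toLp _ with hw
  have hwe := hm.coeFn_toLp
  have h1 : ‖w‖ ≤ ‖r‖ + (κ * ((√l)⁻¹ * ‖w‖)) * √T := by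
    refine norm_le_add hT (by positivity) ?_
    filter_upwards [h, hwe, ae_restrict_mem measurableSet_Icc] with t h1 h2 ht
    have hcalc : |(∫ s in t₀..t, |d s|)| = |(∫ s in t₀..t, Real.exp (l * |s - t₀|) * |w s|)| := by
      congr 1
      refine intervalIntegral.integral_congr_ae ?_
      filter_upwards [(ae_restrict_iff' measurableSet_Icc).1 hwe] with s hs hs'
      rw [hs (uIcc_subset_Icc ht₀ ht (uIoc_subset_uIcc hs')), abs_mul, abs_abs,
        abs_of_pos (Real.exp_pos _), ← mul_assoc, ← Real.exp_add]
      simp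
    have hle : Real.exp (-l * |t - t₀|) ≤ 1 :=
      Real.exp_le_one_iff.2 (by nlinarith [abs_nonneg (t - t₀)])
    have h3 := exp_mul_abs_integral_le hl0 w ht₀ ht
    rw [hcalc] at h1
    rw [h2, abs_mul, abs_abs, abs_of_pos (Real.exp_pos _)]
    calc _ ≤ Real.exp (-l * |t - t₀|) *
          (|r t| + κ * |(∫ s in t₀..t, Real.exp (l * |s - t₀|) * |w s|)|) := by gcongr
      _ = Real.exp (-l * |t - t₀|) * |r t| + κ * (Real.exp (-l * |t - t₀|) *
          |(∫ s in t₀..t, Real.exp (l * |s - t₀|) * |w s|)|) := by ring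
      _ ≤ 1 * |r t| + κ * ((√l)⁻¹ * ‖w‖) := by gcongr
      _ = _ := by rw [one_mul]
  have h2 : (κ * ((√l)⁻¹ * ‖w‖)) * √T ≤ 1 / 2 * ‖w‖ := by
    have : κ * (√l)⁻¹ * √T ≤ 1 / 2 := by
      rw [hsl, mul_right_comm, ← div_eq_mul_inv, div_le_div_iff₀ (by positivity) two_pos]
      linarith
    calc _ = κ * (√l)⁻¹ * √T * ‖w‖ := by ring
      _ ≤ _ := by gcongr
  have h3 : ‖w‖ ≤ 2 * ‖r‖ := by linarith
  have h4 : ‖d‖ ≤ Real.exp (l * T) * ‖w‖ := by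
    refine Lp.norm_le_mul_norm_of_ae_le_mul ?_
    filter_upwards [hwe, ae_restrict_mem measurableSet_Icc] with t h2 ht
    rw [h2, norm_mul, Real.norm_eq_abs, Real.norm_eq_abs, abs_of_pos (Real.exp_pos _),
      norm_abs_eq_norm, ← mul_assoc, ← Real.exp_add, Real.norm_eq_abs]
    refine le_mul_of_one_le_left (abs_nonneg _) (Real.one_le_exp ?_)
    have : |t - t₀| ≤ T := abs_le.2 ⟨by linarith [ht.1, ht₀.2], by linarith [ht.2, ht₀.1]⟩
    nlinarith
  calc ‖d‖ ≤ Real.exp (l * T) * ‖w‖ := h4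
    _ ≤ Real.exp (l * T) * (2 * ‖r‖) := by gcongr
    _ = _ := by ring

/-- Dominated convergence on an interval of finite length; it turns pointwise convergence of
trajectories into `L²` convergence of feedback laws. -/
theorem tendsto_norm_toControl_zero {f : ℕ → ℝ → ℝ} {K : ℝ}
    (hf : ∀ n, ContinuousOn (f n) (Icc 0 T)) (hK : ∀ n, ∀ t ∈ Icc 0 T, |f n t| ≤ K)
    (h : ∀ t ∈ Icc 0 T, Tendsto (fun n => f n t) atTop (𝓝 0)) :
    Tendsto (fun n => ‖toControl T (f n)‖) atTop (𝓝 0) := by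
  have h1 : Tendsto (fun n => ‖toControl T (f n)‖ ^ 2) atTop (𝓝 0) := by
    have e : ∀ n, ‖toControl T (f n)‖ ^ 2 = ∫ t in Icc 0 T, f n t ^ 2 := fun n => by
      rw [norm_sq_eq]
      refine integral_congr_ae ?_
      filter_upwards [toControl_ae (hf n)] with t ht
      rw [ht]
    simp_rw [e]
    have h0 : ∫ t in Icc 0 T, (0 : ℝ) = 0 := by simp
    nth_rewrite 2 [← h0]
    refine tendsto_integral_of_dominated_convergence (μ := volume.restrict (Icc 0 T))
      (fun _ => K ^ 2) (fun n => ContinuousOn.aestronglyMeasurable (f := fun t => f n t ^ 2)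
        ((hf n).pow 2) measurableSet_Icc) (integrable_const _) ?_ ?_
    · intro n
      filter_upwards [ae_restrict_mem measurableSet_Icc] with t ht
      rw [Real.norm_eq_abs, abs_of_nonneg (sq_nonneg _)]
      exact sq_le_sq' (abs_le.1 (hK n t ht)).1 (abs_le.1 (hK n t ht)).2
    · filter_upwards [ae_restrict_mem measurableSet_Icc] with t ht
      simpa using (h t ht).pow 2
  have h2 := h1.sqrt
  simpa using h2

theorem toControl_sub {f g : ℝ → ℝ} (hf : ContinuousOn f (Icc 0 T))
    (hg : ContinuousOn g (Icc 0 T)) :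
    toControl T f - toControl T g = toControl T fun s => f s - g s := by
  refine Lp.ext ?_
  filter_upwards [Lp.coeFn_sub (toControl T f) (toControl T g), toControl_ae hf, toControl_ae hg,
    toControl_ae (f := fun s => f s - g s) (hf.sub hg)] with t h1 h2 h3 h4
  rw [h1, h4, Pi.sub_apply, h2, h3]

end ControlSpace

end Control

/-! ### Skew evolution equations: energy estimate, existence, duality, weak continuity -/

section Evolution

variable {F : Type*} [NormedAddCommGroup F] [InnerProductSpace ℝ F]

/-- A strongly continuous, uniformly bounded family of skew-adjoint operators. -/
structure IsSkewFamily (C : ℝ → F →L[ℝ] F) (M : ℝ) : Prop where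
  nonneg : 0 ≤ M
  bound : ∀ s x, ‖C s x‖ ≤ M * ‖x‖
  continuous : ∀ x, Continuous fun s => C s x
  skew : ∀ s x y, (inner ℝ (C s x) y : ℝ) = -inner ℝ x (C s y)

/-- `X` solves `X' = a(t) C(t) X`, `X(t₀) = x₀` on `[0,T]`, in integrated form. -/
def IsEvolution (C : ℝ → F →L[ℝ] F) (T : ℝ) (a : ℝ → ℝ) (t₀ : ℝ) (x₀ : F) (X : ℝ → F) : Prop :=
  ContinuousOn X (Icc 0 T) ∧ ∀ t ∈ Icc (0 : ℝ) T, X t = x₀ + ∫ s in t₀..t, a s • C s (X s)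

/-- The uniform bound upgrades strong continuity to joint continuity along continuous curves. -/
theorem IsSkewFamily.continuousOn_apply {C : ℝ → F →L[ℝ] F} {M : ℝ} (hC : IsSkewFamily C M)
    {X : ℝ → F} {S : Set ℝ} (hX : ContinuousOn X S) : ContinuousOn (fun s => C s (X s)) S := by
  intro s hs
  have h1 : Tendsto (fun r => M * ‖X r - X s‖ + ‖C r (X s) - C s (X s)‖) (𝓝[S] s) (𝓝 0) := by
    have e1 := ((hX s hs).sub_const (X s)).norm.const_mul M
    have e2 := (((hC.continuous (X s)).continuousWithinAt (s := S) (x := s)).sub_const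
      (C s (X s))).norm
    simpa using e1.add e2
  refine tendsto_iff_norm_sub_tendsto_zero.2
    (squeeze_zero (fun _ => norm_nonneg _) (fun r => ?_) h1)
  have e : C r (X r) - C s (X s) = C r (X r - X s) + (C r (X s) - C s (X s)) := by
    rw [map_sub]; abel
  rw [e]
  exact (norm_add_le _ _).trans (by gcongr; exact hC.bound _ _)

theorem IsSkewFamily.inner_self {C : ℝ → F →L[ℝ] F} {M : ℝ} (hC : IsSkewFamily C M) (s : ℝ)
    (x : F) : (inner ℝ x (C s x) : ℝ) = 0 := by
  have := hC.skew s x x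
  rw [real_inner_comm] at this
  linarith

theorem IsSkewFamily.intervalIntegrable {C : ℝ → F →L[ℝ] F} {M T : ℝ} (hT : 0 ≤ T)
    (hC : IsSkewFamily C M) (a : ControlSpace T) {X : ℝ → F} (hX : ContinuousOn X (Icc 0 T)) :
    IntervalIntegrable (fun s => a s • C s (X s)) volume 0 T := by
  refine (a.intervalIntegrable hT).smul_continuousOn ?_
  rw [uIcc_of_le hT]
  exact hC.continuousOn_apply hX

theorem IsEvolution.apply_self {C : ℝ → F →L[ℝ] F} {T : ℝ} {a : ℝ → ℝ} {t₀ : ℝ}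
    (ht₀ : t₀ ∈ Icc 0 T) {x₀ : F} {X : ℝ → F} (hX : IsEvolution C T a t₀ x₀ X) : X t₀ = x₀ := by
  simpa using hX.2 t₀ ht₀

/-- The pairing `⟨Y(t), C(t) X(t)⟩`. -/
def pairing (C : ℝ → F →L[ℝ] F) (Y X : ℝ → F) (t : ℝ) : ℝ := inner ℝ (Y t) (C t (X t))

theorem IsSkewFamily.continuousOn_pairing {C : ℝ → F →L[ℝ] F} {M : ℝ} (hC : IsSkewFamily C M)
    {Y X : ℝ → F} {S : Set ℝ} (hY : ContinuousOn Y S) (hX : ContinuousOn X S) :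
    ContinuousOn (pairing C Y X) S :=
  hY.inner (hC.continuousOn_apply hX)

theorem IsSkewFamily.abs_pairing_sub_le {C : ℝ → F →L[ℝ] F} {M : ℝ} (hC : IsSkewFamily C M)
    (Y X Y' X' : ℝ → F) (t : ℝ) :
    |pairing C Y X t - pairing C Y' X' t|
      ≤ M * (‖Y t - Y' t‖ * ‖X t‖ + ‖Y' t‖ * ‖X t - X' t‖) := by
  have e : pairing C Y X t - pairing C Y' X' t
      = inner ℝ (Y t - Y' t) (C t (X t)) + inner ℝ (Y' t) (C t (X t - X' t)) := by
    simp only [pairing, map_sub, inner_sub_left, inner_sub_right]; ring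
  rw [e, mul_add]
  refine (abs_add_le _ _).trans (add_le_add ?_ ?_)
  · refine (abs_real_inner_le_norm _ _).trans ?_
    calc _ ≤ ‖Y t - Y' t‖ * (M * ‖X t‖) := by gcongr; exact hC.bound _ _
      _ = _ := by ring
  · refine (abs_real_inner_le_norm _ _).trans ?_
    calc _ ≤ ‖Y' t‖ * (M * ‖X t - X' t‖) := by gcongr; exact hC.bound _ _
      _ = _ := by ring

variable [CompleteSpace F] {C : ℝ → F →L[ℝ] F} {M T : ℝ}

/-- Energy estimate for the inhomogeneous equation. -/
theorem IsSkewFamily.norm_le (hT : 0 ≤ T) (hC : IsSkewFamily C M) (a : ControlSpace T)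
    {t₀ : ℝ} (ht₀ : t₀ ∈ Icc 0 T) {h Z : ℝ → F} {z₀ : F} {g : ℝ → ℝ}
    (hZc : ContinuousOn Z (Icc 0 T)) (hh : IntervalIntegrable h volume 0 T)
    (hg : IntervalIntegrable g volume 0 T)
    (hhg : ∀ᵐ s ∂((volume : Measure ℝ).restrict (Icc (0 : ℝ) T)), ‖h s‖ ≤ g s)
    (hZ : ∀ t ∈ Icc 0 T, Z t = z₀ + ∫ s in t₀..t, (a s • C s (Z s) + h s)) {t : ℝ}
    (ht : t ∈ Icc 0 T) : ‖Z t‖ ≤ ‖z₀‖ + 2 * |∫ s in t₀..t, g s| := by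
  have hsub : uIcc t₀ t ⊆ Icc 0 T := uIcc_subset_Icc ht₀ ht
  -- Comparing energies at `t₀` and at the maximum point `r`, skewness removes the control term and
  -- leaves `‖Z r‖² ≤ ‖z₀‖² + 2 ‖Z r‖ |∫ g|`; dividing by `‖Z r‖` gives a bound independent of `a`.
  obtain ⟨r, hr, hmax⟩ := isCompact_uIcc.exists_isMaxOn nonempty_uIcc (hZc.norm.mono hsub)
  have hmax' : ∀ s ∈ uIcc t₀ t, ‖Z s‖ ≤ ‖Z r‖ := hmax
  have hw := (hC.intervalIntegrable hT a hZc).add hh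
  have h1 := inner_sub_inner_eq_integral hT ht₀ ht₀ hw hw hZ hZ ht₀ (hsub hr)
  have hz0 : Z t₀ = z₀ := by simpa using hZ t₀ ht₀
  rw [real_inner_self_eq_norm_sq, real_inner_self_eq_norm_sq, hz0] at h1
  have hru : uIoc t₀ r ⊆ uIoc t₀ t :=
    uIoc_subset_uIoc_of_uIcc_subset_uIcc (uIcc_subset_uIcc_left hr)
  have hut : uIoc t₀ t ⊆ Icc 0 T := uIoc_subset_uIcc.trans hsub
  have hgt := hg.mono_Icc hT ht₀ ht
  have hgr := hg.mono_Icc hT ht₀ (hsub hr)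
  have h2 : ‖∫ s in t₀..r, ((inner ℝ (a s • C s (Z s) + h s) (Z s) : ℝ)
      + inner ℝ (Z s) (a s • C s (Z s) + h s))‖ ≤ |∫ s in t₀..r, 2 * ‖Z r‖ * g s| := by
    refine intervalIntegral.norm_integral_le_abs_of_norm_le ?_ (hgr.const_mul _)
    filter_upwards [ae_restrict_of_ae_restrict_of_subset (hru.trans hut) hhg,
      ae_restrict_mem measurableSet_uIoc] with s hs hs'
    have e : (inner ℝ (a s • C s (Z s) + h s) (Z s) : ℝ)
        + inner ℝ (Z s) (a s • C s (Z s) + h s) = 2 * inner ℝ (Z s) (h s) := by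
      rw [real_inner_comm, inner_add_right, real_inner_smul_right, hC.inner_self]; ring
    rw [e, norm_mul, Real.norm_two, mul_assoc]
    gcongr
    exact (norm_inner_le_norm _ _).trans (mul_le_mul (hmax' s (uIoc_subset_uIcc (hru hs'))) hs
      (norm_nonneg _) (norm_nonneg _))
  have h3 : |∫ s in t₀..r, g s| ≤ |∫ s in t₀..t, g s| := by
    refine intervalIntegral.abs_integral_mono_interval hru ?_ hgt
    filter_upwards [ae_restrict_of_ae_restrict_of_subset hut hhg] with s hs
    exact (norm_nonneg _).trans hs
  rw [← h1, intervalIntegral.integral_const_mul, abs_mul, abs_of_nonneg (by positivity)] at h2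
  have h4 := (le_abs_self _).trans h2
  have h5 : ‖Z r‖ ≤ ‖z₀‖ + 2 * |∫ s in t₀..t, g s| := by
    by_contra hcon
    push Not at hcon
    have hn := norm_nonneg z₀
    have hI := abs_nonneg (∫ s in t₀..t, g s)
    have h6 := mul_le_mul_of_nonneg_left h3 (norm_nonneg (Z r))
    have h7 : 0 < ‖Z r‖ := by linarith
    nlinarith [mul_lt_mul_of_pos_left hcon h7]
  exact (hmax' t right_mem_uIcc).trans h5

theorem IsEvolution.norm_le (hT : 0 ≤ T) (hC : IsSkewFamily C M) {a : ControlSpace T} {t₀ : ℝ}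
    (ht₀ : t₀ ∈ Icc 0 T) {x₀ : F} {X : ℝ → F} (hX : IsEvolution C T a t₀ x₀ X) {t : ℝ}
    (ht : t ∈ Icc 0 T) : ‖X t‖ ≤ ‖x₀‖ := by
  have h := hC.norm_le hT a ht₀ (h := fun _ => 0) (g := fun _ => 0) hX.1 (by simp) (by simp)
    (by simp) (by simpa using hX.2) ht
  simpa using h

/-- Lipschitz dependence of the solution on the control and on the initial datum. -/
theorem IsEvolution.norm_sub_le_integral (hT : 0 ≤ T) (hC : IsSkewFamily C M)
    {a b : ControlSpace T} {t₀ : ℝ} (ht₀ : t₀ ∈ Icc 0 T) {x₀ y₀ : F} {X Y : ℝ → F}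
    (hX : IsEvolution C T a t₀ x₀ X) (hY : IsEvolution C T b t₀ y₀ Y) {t : ℝ}
    (ht : t ∈ Icc 0 T) :
    ‖X t - Y t‖ ≤ ‖x₀ - y₀‖ + 2 * (M * ‖y₀‖) * |(∫ s in t₀..t, |(a - b) s|)| := by
  have hXi := hC.intervalIntegrable hT a hX.1
  have hYi := hC.intervalIntegrable hT b hY.1
  have hYa := hC.intervalIntegrable hT a hY.1
  have hg : IntervalIntegrable (fun s => M * ‖y₀‖ * |(a - b) s|) volume 0 T :=
    ((a - b).intervalIntegrable hT).abs.const_mul _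
  -- The difference solves the equation with control `a` and source `(a - b) C Y`, where `‖Y‖ ≤
  -- ‖y₀‖`.
  have h := hC.norm_le hT a ht₀ (Z := fun t => X t - Y t) (z₀ := x₀ - y₀)
    (h := fun s => a s • C s (Y s) - b s • C s (Y s)) (hX.1.sub hY.1) (hYa.sub hYi) hg ?_ ?_ ht
  · rwa [intervalIntegral.integral_const_mul, abs_mul, abs_of_nonneg
      (mul_nonneg hC.nonneg (norm_nonneg _)), ← mul_assoc] at h
  · filter_upwards [Lp.coeFn_sub a b, ae_restrict_mem measurableSet_Icc] with s hs hs'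
    rw [hs, Pi.sub_apply, ← sub_smul, norm_smul, Real.norm_eq_abs, mul_comm]
    gcongr
    exact (hC.bound _ _).trans
      (mul_le_mul_of_nonneg_left (hY.norm_le hT hC ht₀ hs') hC.nonneg)
  · intro t ht
    rw [hX.2 t ht, hY.2 t ht, add_sub_add_comm, ← intervalIntegral.integral_sub
      (hXi.mono_Icc hT ht₀ ht) (hYi.mono_Icc hT ht₀ ht)]
    congr 1
    refine intervalIntegral.integral_congr fun s _ => ?_
    simp only [map_sub, smul_sub]
    abel

theorem IsEvolution.norm_sub_le (hT : 0 ≤ T) (hC : IsSkewFamily C M)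
    {a b : ControlSpace T} {t₀ : ℝ} (ht₀ : t₀ ∈ Icc 0 T) {x₀ y₀ : F} {X Y : ℝ → F}
    (hX : IsEvolution C T a t₀ x₀ X) (hY : IsEvolution C T b t₀ y₀ Y) {t : ℝ}
    (ht : t ∈ Icc 0 T) :
    ‖X t - Y t‖ ≤ ‖x₀ - y₀‖ + 2 * (M * ‖y₀‖) * (√T * ‖a - b‖) := by
  refine (hX.norm_sub_le_integral hT hC ht₀ hY ht).trans ?_
  have := hC.nonneg
  gcongr
  exact (a - b).abs_integral_abs_le hT ht₀ ht

theorem IsEvolution.eq (hT : 0 ≤ T) (hC : IsSkewFamily C M) {a : ControlSpace T} {t₀ : ℝ}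
    (ht₀ : t₀ ∈ Icc 0 T) {x₀ : F} {X Y : ℝ → F} (hX : IsEvolution C T a t₀ x₀ X)
    (hY : IsEvolution C T a t₀ x₀ Y) {t : ℝ} (ht : t ∈ Icc 0 T) : X t = Y t := by
  have := hX.norm_sub_le hT hC ht₀ hY ht
  rw [sub_self, sub_self] at this
  simpa [sub_eq_zero] using this

/-- Banach's fixed point theorem in an exponentially weighted sup norm: the unknown is `exp (-l |t -
t₀|) X(t)`, and `l` is chosen to make the Lipschitz constant `M ‖a‖ / √l` at most `1/2`. -/
theorem exists_isEvolution (hT : 0 ≤ T) (hC : IsSkewFamily C M) (a : ControlSpace T) {t₀ : ℝ}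
    (ht₀ : t₀ ∈ Icc 0 T) (x₀ : F) : ∃ X, IsEvolution C T a t₀ x₀ X := by
  have hM := hC.nonneg
  set l : ℝ := (2 * (M * ‖a‖ + 1)) ^ 2 with hl
  have hl0 : 0 < l := by positivity
  have hsl : √l = 2 * (M * ‖a‖ + 1) := Real.sqrt_sq (by positivity)
  let Y : C(Icc 0 T, F) → ℝ → F := fun y s => Real.exp (l * |s - t₀|) • IccExtend hT y s
  have hY : ∀ y, ContinuousOn (Y y) (Icc 0 T) := fun y =>
    ((by fun_prop : Continuous fun s : ℝ => Real.exp (l * |s - t₀|)).smul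
      y.continuous.Icc_extend').continuousOn
  let V : C(Icc 0 T, F) → ℝ → F := fun y t =>
    Real.exp (-l * |t - t₀|) • (x₀ + ∫ s in t₀..t, a s • C s (Y y s))
  have hV : ∀ y, ContinuousOn (V y) (Icc 0 T) := fun y =>
    (by fun_prop : Continuous fun s : ℝ => Real.exp (-l * |s - t₀|)).continuousOn.smul
      (continuousOn_of_eq_integral hT ht₀ (hC.intervalIntegrable hT a (hY y)) fun _ _ => rfl)
  let Φ : C(Icc 0 T, F) → C(Icc 0 T, F) := fun y =>
    ⟨(Icc 0 T).domRestrict (V y), (hV y).domRestrict⟩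
  have hΦ : ContractingWith (1 / 2) Φ := by
    refine ⟨by norm_num, LipschitzWith.of_dist_le_mul fun y z => ?_⟩
    refine (ContinuousMap.dist_le (by positivity)).2 fun ⟨t, ht⟩ => ?_
    have hyi := (hC.intervalIntegrable hT a (hY y)).mono_Icc hT ht₀ ht
    have hzi := (hC.intervalIntegrable hT a (hY z)).mono_Icc hT ht₀ ht
    have e1 : Φ y ⟨t, ht⟩ - Φ z ⟨t, ht⟩ = Real.exp (-l * |t - t₀|) •
        ∫ s in t₀..t, (a s • C s (Y y s) - a s • C s (Y z s)) := by
      change V y t - V z t = _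
      simp only [V]
      rw [← smul_sub, add_sub_add_left_eq_sub, ← intervalIntegral.integral_sub hyi hzi]
    have hci : IntervalIntegrable (fun s => M * dist y z * (Real.exp (l * |s - t₀|) * |a s|))
        volume t₀ t := by
      refine (IntervalIntegrable.const_mul ?_ _)
      exact ((a.intervalIntegrable hT).abs.mono_Icc hT ht₀ ht).continuousOn_mul
        (by fun_prop : Continuous fun s : ℝ => Real.exp (l * |s - t₀|)).continuousOn
    have e2 : ‖∫ s in t₀..t, (a s • C s (Y y s) - a s • C s (Y z s))‖
        ≤ |∫ s in t₀..t, M * dist y z * (Real.exp (l * |s - t₀|) * |a s|)| := by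
      refine intervalIntegral.norm_integral_le_abs_of_norm_le
        (Eventually.of_forall fun s => ?_) hci
      rw [← smul_sub, ← map_sub, norm_smul, Real.norm_eq_abs]
      have e3 : ‖Y y s - Y z s‖ ≤ Real.exp (l * |s - t₀|) * dist y z := by
        simp only [Y]
        rw [← smul_sub, norm_smul, Real.norm_eq_abs, abs_of_pos (Real.exp_pos _), ← dist_eq_norm]
        gcongr
        exact ContinuousMap.dist_apply_le_dist _
      calc _ ≤ |a s| * (M * (Real.exp (l * |s - t₀|) * dist y z)) := by
            gcongr
            exact (hC.bound _ _).trans (by gcongr)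
        _ = _ := by ring
    rw [intervalIntegral.integral_const_mul, abs_mul, abs_of_nonneg (by positivity)] at e2
    rw [dist_eq_norm, e1, norm_smul, Real.norm_eq_abs, abs_of_pos (Real.exp_pos _)]
    calc _ ≤ Real.exp (-l * |t - t₀|) * (M * dist y z *
          |(∫ s in t₀..t, Real.exp (l * |s - t₀|) * |a s|)|) := by gcongr
      _ = M * dist y z * (Real.exp (-l * |t - t₀|) *
          |(∫ s in t₀..t, Real.exp (l * |s - t₀|) * |a s|)|) := by ring
      _ ≤ M * dist y z * ((√l)⁻¹ * ‖a‖) := by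
          exact mul_le_mul_of_nonneg_left (a.exp_mul_abs_integral_le hl0 ht₀ ht) (by positivity)
      _ = (M * ‖a‖ / √l) * dist y z := by ring
      _ ≤ _ := by
          gcongr
          rw [hsl, div_le_iff₀ (by positivity)]
          push_cast
          linarith
  have hfix := hΦ.fixedPoint_isFixedPt
  set y := ContractingWith.fixedPoint Φ hΦ with hy
  have hval : ∀ t ∈ Icc 0 T, Y y t = x₀ + ∫ s in t₀..t, a s • C s (Y y s) := by
    intro t ht
    have h1 : y ⟨t, ht⟩ = V y t := by
      conv_lhs => rw [← hfix.eq]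
      rfl
    simp only [Y] at h1 ⊢
    rw [IccExtend_of_mem hT _ ht, h1]
    simp only [V]
    rw [smul_smul, ← Real.exp_add]
    simp [Y]
  exact ⟨Y y, hY y, hval⟩

/-- Duality between a forward and a backward evolution. -/
theorem IsEvolution.inner_sub_inner (hT : 0 ≤ T) (hC : IsSkewFamily C M) {a b : ControlSpace T}
    {t₀ t₁ : ℝ} (ht₀ : t₀ ∈ Icc 0 T) (ht₁ : t₁ ∈ Icc 0 T) {x₀ y₀ : F} {X Y : ℝ → F}
    (hX : IsEvolution C T a t₀ x₀ X) (hY : IsEvolution C T b t₁ y₀ Y) :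
    (inner ℝ (Y T) (X T) : ℝ) - inner ℝ (Y 0) (X 0)
      = inner ℝ (a - b) (toControl T (pairing C Y X)) := by
  rw [inner_sub_inner_eq_integral hT ht₁ ht₀ (hC.intervalIntegrable hT b hY.1)
    (hC.intervalIntegrable hT a hX.1) hY.2 hX.2 ⟨le_rfl, hT⟩ ⟨hT, le_rfl⟩,
    intervalIntegral.integral_of_le hT, ← integral_Icc_eq_integral_Ioc, ControlSpace.inner_eq]
  refine integral_congr_ae ?_
  filter_upwards [toControl_ae (hC.continuousOn_pairing hY.1 hX.1), Lp.coeFn_sub a b] with s h1 h2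
  rw [h1, h2, Pi.sub_apply, pairing, real_inner_smul_left, real_inner_smul_right, hC.skew]
  ring

/-- The solution map is continuous from the weak topology of controls to the strong topology. -/
theorem IsEvolution.tendsto_of_weaklyTendsto (hT : 0 ≤ T) (hC : IsSkewFamily C M)
    {a : ℕ → ControlSpace T} {e : ControlSpace T} (ha : WeaklyTendsto a e) {K : ℝ}
    (hK : ∀ n, ‖a n‖ ≤ K) {t₀ : ℝ} (ht₀ : t₀ ∈ Icc 0 T) {x : ℕ → F} {x₀ : F}
    (hx : Tendsto x atTop (𝓝 x₀)) {X : ℕ → ℝ → F} {X₀ : ℝ → F}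
    (hX : ∀ n, IsEvolution C T (a n) t₀ (x n) (X n)) (hX₀ : IsEvolution C T e t₀ x₀ X₀)
    {t : ℝ} (ht : t ∈ Icc 0 T) : Tendsto (fun n => X n t) atTop (𝓝 (X₀ t)) := by
  have hM := hC.nonneg
  set G : ℝ → F := fun s => C s (X₀ s) with hG
  have hGc : ContinuousOn G (Icc 0 T) := hC.continuousOn_apply hX₀.1
  have hGb : ∀ s ∈ Icc 0 T, ‖G s‖ ≤ M * ‖x₀‖ := fun s hs => (hC.bound _ _).trans
    (mul_le_mul_of_nonneg_left (hX₀.norm_le hT hC ht₀ hs) hM)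
  have hdK : ∀ n, ‖a n - e‖ ≤ K + ‖e‖ := fun n =>
    (_root_.norm_sub_le _ _).trans (add_le_add_left (hK n) _)
  have hdi : ∀ n, IntervalIntegrable (fun s => (a n - e) s • G s) volume 0 T := fun n =>
    hC.intervalIntegrable hT (a n - e) hX₀.1
  -- `X n - X₀` solves an equation with source `(a n - e) G`, which is only weakly small. Its
  -- primitive `v n` is small in norm at each time, and subtracting it leaves a source that can be
  -- estimated.
  set v : ℕ → ℝ → F := fun n t => ∫ s in t₀..t, (a n - e) s • G s with hv
  have hvc : ∀ n, ContinuousOn (v n) (Icc 0 T) := fun n =>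
    continuousOn_of_eq_integral (x₀ := 0) hT ht₀ (hdi n) fun t _ => (zero_add _).symm
  have hvb : ∀ n, ∀ t ∈ Icc 0 T, ‖v n t‖ ≤ M * ‖x₀‖ * (√T * (K + ‖e‖)) := by
    intro n t ht
    have h1 : ‖v n t‖ ≤ |(∫ s in t₀..t, M * ‖x₀‖ * |(a n - e) s|)| := by
      refine intervalIntegral.norm_integral_le_abs_of_norm_le ?_
        ((((a n - e).intervalIntegrable hT).abs.const_mul _).mono_Icc hT ht₀ ht)
      filter_upwards [ae_restrict_mem measurableSet_uIoc] with s hs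
      rw [norm_smul, Real.norm_eq_abs, mul_comm]
      gcongr
      exact hGb s (uIcc_subset_Icc ht₀ ht (uIoc_subset_uIcc hs))
    rw [intervalIntegral.integral_const_mul, abs_mul, abs_of_nonneg (by positivity)] at h1
    refine h1.trans ?_
    gcongr
    refine ((a n - e).abs_integral_abs_le hT ht₀ ht).trans ?_
    gcongr
    exact hdK n
  have hinner : ∀ n, ∀ t ∈ Icc 0 T, ∀ y : F,
      (inner ℝ y (v n t) : ℝ) = ∫ s in t₀..t, (a n - e) s * inner ℝ y (G s) := by
    intro n t ht y
    have := ((innerSL ℝ y).intervalIntegral_comp_comm ((hdi n).mono_Icc hT ht₀ ht)).symm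
    simpa only [innerSL_apply_apply, real_inner_smul_right] using this
  have hvweak : ∀ t ∈ Icc 0 T, ∀ y : F, Tendsto (fun n => (inner ℝ (v n t) y : ℝ)) atTop (𝓝 0) := by
    intro t ht y
    have hm : MemLp ((uIoc t₀ t).indicator fun s => (inner ℝ y (G s) : ℝ)) 2
        ((volume : Measure ℝ).restrict (Icc (0 : ℝ) T)) :=
      (memLp_two_of_continuousOn (continuousOn_const.inner hGc)).indicator measurableSet_uIoc
    have h1 : ∀ n, (inner ℝ (v n t) y : ℝ) = (if t₀ ≤ t then (1 : ℝ) else -1) •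
        (inner ℝ (hm.toLp _) (a n) - inner ℝ (hm.toLp _) e) := by
      intro n
      rw [real_inner_comm, hinner n t ht, intervalIntegral.intervalIntegral_eq_integral_uIoc,
        ← inner_sub_right, ControlSpace.inner_eq]
      congr 1
      have hset : uIoc t₀ t = Icc 0 T ∩ uIoc t₀ t :=
        (inter_eq_right.2 (uIoc_subset_uIcc.trans (uIcc_subset_Icc ht₀ ht))).symm
      conv_lhs => rw [hset, ← setIntegral_indicator measurableSet_uIoc]
      refine integral_congr_ae ?_
      filter_upwards [hm.coeFn_toLp] with s hs
      rw [hs]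
      by_cases hsm : s ∈ uIoc t₀ t <;> simp [hsm, mul_comm]
    simp_rw [h1]
    have h2 := ((ha (hm.toLp _)).sub_const (inner ℝ (hm.toLp _) e)).const_smul
      (if t₀ ≤ t then (1 : ℝ) else -1)
    simpa using h2
  -- From weak to strong without any compactness: `‖v n t‖²` is the integral of `(a n - e) s`
  -- against `⟨v n t, G s⟩`. The first factor is bounded in `L²`, and the second tends to zero for
  -- each `s` by weak convergence, hence in `L²` by domination.
  have hvt : ∀ t ∈ Icc 0 T, Tendsto (fun n => v n t) atTop (𝓝 0) := by
    intro t ht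
    have hc : ∀ n, ContinuousOn (fun s => |(inner ℝ (v n t) (G s) : ℝ)|) (Icc 0 T) := fun n =>
      (continuousOn_const.inner hGc).abs
    have h1 : ∀ n, ‖v n t‖ ^ 2
        ≤ ‖toControl T fun s => |(inner ℝ (v n t) (G s) : ℝ)|‖ * (K + ‖e‖) := by
      intro n
      rw [← real_inner_self_eq_norm_sq, hinner n t ht]
      have hi : IntervalIntegrable (fun s => |(inner ℝ (v n t) (G s) : ℝ)| * |(a n - e) s|)
          volume t₀ t := by
        refine IntervalIntegrable.mono_Icc hT ?_ ht₀ ht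
        rw [intervalIntegrable_iff_integrableOn_Icc_of_le hT]
        exact ControlSpace.integrableOn_mul_abs (hc n) _
      have h2 : |∫ s in t₀..t, (a n - e) s * inner ℝ (v n t) (G s)|
          ≤ |(∫ s in t₀..t, |(inner ℝ (v n t) (G s) : ℝ)| * |(a n - e) s|)| := by
        rw [← Real.norm_eq_abs]
        refine intervalIntegral.norm_integral_le_abs_of_norm_le (Eventually.of_forall fun s => ?_) hi
        rw [norm_mul, mul_comm, Real.norm_eq_abs, Real.norm_eq_abs]
      refine (le_abs_self _).trans (h2.trans ?_)
      refine (ControlSpace.abs_integral_mul_abs_le (hc n) (fun _ => abs_nonneg _) _ ht₀ ht).trans ?_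
      gcongr
      exact hdK n
    have h3 : Tendsto (fun n => ‖toControl T fun s => |(inner ℝ (v n t) (G s) : ℝ)|‖ * (K + ‖e‖))
        atTop (𝓝 0) := by
      have := ControlSpace.tendsto_norm_toControl_zero (T := T)
        (K := M * ‖x₀‖ * (√T * (K + ‖e‖)) * (M * ‖x₀‖)) hc (fun n s hs => ?_)
        (fun s hs => by simpa using (hvweak t ht (G s)).abs)
      · simpa using this.mul_const (K + ‖e‖)
      · rw [abs_abs]
        have h0 := hvb n t ht
        exact (abs_real_inner_le_norm _ _).trans (mul_le_mul h0 (hGb s hs)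
          (norm_nonneg _) ((norm_nonneg _).trans h0))
    have h4 := (squeeze_zero (fun n => sq_nonneg ‖v n t‖) h1 h3).sqrt
    rw [tendsto_zero_iff_norm_tendsto_zero]
    simpa using h4
  -- After the subtraction the control is `a n` and the source is `a n C (v n)`, controlled by the
  -- `L²` norm of `v n`.
  have hz : ∀ n, ‖X n t - X₀ t - v n t‖
      ≤ ‖x n - x₀‖ + 2 * (‖toControl T fun s => M * ‖v n s‖‖ * K) := by
    intro n
    have hc : ContinuousOn (fun s => M * ‖v n s‖) (Icc 0 T) :=
      continuousOn_const.mul (hvc n).norm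
    have hg : IntervalIntegrable (fun s => M * ‖v n s‖ * |a n s|) volume 0 T := by
      rw [intervalIntegrable_iff_integrableOn_Icc_of_le hT]
      exact ControlSpace.integrableOn_mul_abs hc _
    have hXi := hC.intervalIntegrable hT (a n) (hX n).1
    have hX₀i := hC.intervalIntegrable hT e hX₀.1
    have h := hC.norm_le hT (a n) ht₀ (Z := fun t => X n t - X₀ t - v n t) (z₀ := x n - x₀)
      (h := fun s => a n s • C s (v n s)) (((hX n).1.sub hX₀.1).sub (hvc n))
      (hC.intervalIntegrable hT (a n) (hvc n)) hg (Eventually.of_forall fun s => ?_) ?_ ht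
    · refine h.trans ?_
      gcongr
      refine (ControlSpace.abs_integral_mul_abs_le hc
        (fun s => mul_nonneg hM (norm_nonneg _)) _ ht₀ ht).trans ?_
      gcongr
      exact hK n
    · rw [norm_smul, Real.norm_eq_abs, mul_comm]
      gcongr
      exact hC.bound _ _
    · intro t ht
      rw [(hX n).2 t ht, hX₀.2 t ht, add_sub_add_comm, ← intervalIntegral.integral_sub
        (hXi.mono_Icc hT ht₀ ht) (hX₀i.mono_Icc hT ht₀ ht), add_sub_assoc,
        ← intervalIntegral.integral_sub ((hXi.sub hX₀i).mono_Icc hT ht₀ ht)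
        ((hdi n).mono_Icc hT ht₀ ht)]
      congr 1
      refine intervalIntegral.integral_congr_ae ?_
      filter_upwards [(ae_restrict_iff' measurableSet_Icc).1 (Lp.coeFn_sub (a n) e)] with s hs hs'
      rw [hs (uIcc_subset_Icc ht₀ ht (uIoc_subset_uIcc hs')), Pi.sub_apply]
      simp only [hG, map_sub, smul_sub, sub_smul]
      abel
  have hlim : Tendsto (fun n => ‖x n - x₀‖ + 2 * (‖toControl T fun s => M * ‖v n s‖‖ * K)) atTop
      (𝓝 0) := by
    have h1 := ControlSpace.tendsto_norm_toControl_zero (T := T) (f := fun n s => M * ‖v n s‖)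
      (K := M * (M * ‖x₀‖ * (√T * (K + ‖e‖)))) (fun n => continuousOn_const.mul (hvc n).norm)
      (fun n s hs => ?_) (fun s hs => by simpa using (hvt s hs).norm.const_mul M)
    · simpa using (tendsto_iff_norm_sub_tendsto_zero.1 hx).add ((h1.mul_const K).const_mul 2)
    · rw [abs_of_nonneg (by positivity)]
      gcongr
      exact hvb n s hs
  have h5 : Tendsto (fun n => X n t - X₀ t - v n t) atTop (𝓝 0) :=
    squeeze_zero_norm hz hlim
  have h6 := (h5.add (hvt t ht)).add_const (X₀ t)
  simpa using h6

end Evolution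

/-! ### The scheme as relaxation towards a feedback law, and its monotonicity -/

section Scheme

variable {F : Type*} [NormedAddCommGroup F] [InnerProductSpace ℝ F]

/-- Positivity tested on `N x - Q x`. The cost increment only controls `⟨ΔX(T), Q ΔX(T)⟩`, while
comparing adjoint states requires `‖Q ΔX(T)‖`. The `+ 1` allows division by `N` even when `Q = 0`.
-/
theorem norm_apply_sq_le_of_nonneg {Q : F →L[ℝ] F}
    (hQs : ∀ x y, (inner ℝ (Q x) y : ℝ) = inner ℝ x (Q y)) (hQp : ∀ x, 0 ≤ (inner ℝ x (Q x) : ℝ))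
    (x : F) : ‖Q x‖ ^ 2 ≤ (‖Q‖ + 1) * inner ℝ x (Q x) := by
  have hN : 0 < ‖Q‖ + 1 := by positivity
  set N := ‖Q‖ + 1 with hNdef
  have h := hQp (N • x - Q x)
  have e : (inner ℝ (N • x - Q x) (Q (N • x - Q x)) : ℝ)
      = N ^ 2 * inner ℝ x (Q x) - 2 * N * ‖Q x‖ ^ 2 + inner ℝ (Q x) (Q (Q x)) := by
    simp only [map_sub, map_smul, inner_sub_left, inner_sub_right, real_inner_smul_left,
      real_inner_smul_right, ← hQs x (Q x), real_inner_self_eq_norm_sq]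
    ring
  have h2 : (inner ℝ (Q x) (Q (Q x)) : ℝ) ≤ N * ‖Q x‖ ^ 2 := by
    refine (real_inner_le_norm _ _).trans ?_
    calc _ ≤ ‖Q x‖ * (‖Q‖ * ‖Q x‖) := by gcongr; exact Q.le_opNorm _
      _ ≤ ‖Q x‖ * (N * ‖Q x‖) := by gcongr; linarith
      _ = _ := by ring
  rw [e] at h
  have h3 : 0 ≤ N * (N * inner ℝ x (Q x) - ‖Q x‖ ^ 2) := by nlinarith
  linarith [(mul_nonneg_iff_of_pos_left hN).1 h3]

/-- The feedback law `α⁻¹ ⟨Y(t), C(t) X(t)⟩`. -/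
noncomputable def feedback (C : ℝ → F →L[ℝ] F) (α : ℝ) (Y X : ℝ → F) (t : ℝ) : ℝ :=
  α⁻¹ * pairing C Y X t

/-- The iterates of the monotonic scheme in the interaction picture. -/
structure IsFeedbackScheme (C : ℝ → F →L[ℝ] F) (Q : F →L[ℝ] F) (T α δ η : ℝ) (x₀ : F)
    (a b : ℕ → ControlSpace T) (X Y : ℕ → ℝ → F) : Prop where
  state : ∀ k, IsEvolution C T (a k) 0 x₀ (X k)
  adjoint : ∀ k, IsEvolution C T (b k) T (Q (X k T)) (Y k)
  backward : ∀ k, b k - a k = η • (toControl T (feedback C α (Y k) (X k)) - a k)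
  forward : ∀ k, a (k + 1) - b k = δ • (toControl T (feedback C α (Y k) (X (k + 1))) - b k)

theorem IsSkewFamily.continuousOn_feedback {C : ℝ → F →L[ℝ] F} {M : ℝ} (hC : IsSkewFamily C M)
    (α : ℝ) {Y X : ℝ → F} {S : Set ℝ} (hY : ContinuousOn Y S) (hX : ContinuousOn X S) :
    ContinuousOn (feedback C α Y X) S :=
  continuousOn_const.mul (hC.continuousOn_pairing hY hX)

theorem IsSkewFamily.toControl_pairing {C : ℝ → F →L[ℝ] F} {M T : ℝ} (hC : IsSkewFamily C M)
    {α : ℝ} (hα : 0 < α) {Y X : ℝ → F} (hY : ContinuousOn Y (Icc 0 T))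
    (hX : ContinuousOn X (Icc 0 T)) :
    toControl T (pairing C Y X) = α • toControl T (feedback C α Y X) := by
  refine Lp.ext ?_
  filter_upwards [toControl_ae (hC.continuousOn_pairing hY hX),
    toControl_ae (hC.continuousOn_feedback α hY hX),
    Lp.coeFn_smul α (toControl T (feedback C α Y X))] with t h1 h2 h3
  rw [h1, h3, Pi.smul_apply, h2, feedback, smul_eq_mul, mul_inv_cancel_left₀ hα.ne']

/-- Completing the square in a relaxation step from `v` to `u` towards `q`: this is the gain in cost
of half a sweep. For `c = 0` the convention `2 / 0 = 0` is harmless because `u = v`. -/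
theorem two_inner_sub_sub_norm_sq {V : Type*} [NormedAddCommGroup V] [InnerProductSpace ℝ V]
    {c : ℝ} {u v q : V} (h : u - v = c • (q - v)) :
    2 * (inner ℝ (u - v) q : ℝ) - (‖u‖ ^ 2 - ‖v‖ ^ 2) = (2 / c - 1) * ‖u - v‖ ^ 2 := by
  have e1 : 2 * (inner ℝ (u - v) q : ℝ) - (‖u‖ ^ 2 - ‖v‖ ^ 2)
      = 2 * inner ℝ (u - v) (q - v) - ‖u - v‖ ^ 2 := by
    simp only [← real_inner_self_eq_norm_sq, inner_sub_left, inner_sub_right]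
    rw [real_inner_comm u v]
    ring
  rcases eq_or_ne c 0 with rfl | hc
  · rw [e1, h]; simp
  · have e2 : q - v = c⁻¹ • (u - v) := by rw [h, inv_smul_smul₀ hc]
    rw [e1, e2, real_inner_smul_right, real_inner_self_eq_norm_sq]
    ring

/-- At `c = 0` the coefficient is `-1`, but the step is then void; otherwise `c ≤ 2` makes it
nonnegative. -/
theorem coeff_mul_norm_sq_nonneg {V : Type*} [NormedAddCommGroup V] [InnerProductSpace ℝ V]
    {c : ℝ} (hc : c ∈ Icc (0 : ℝ) 2) {u v q : V} (h : u - v = c • (q - v)) :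
    0 ≤ (2 / c - 1) * ‖u - v‖ ^ 2 := by
  rcases eq_or_lt_of_le hc.1 with rfl | hc0
  · rw [h]; simp
  · refine mul_nonneg (sub_nonneg.2 ?_) (sq_nonneg _)
    rw [le_div_iff₀ hc0]; linarith [hc.2]

variable [CompleteSpace F] {C : ℝ → F →L[ℝ] F} {M T : ℝ}

/-- Bilinearity and Lipschitz dependence of the trajectories. The integrals are kept up to time `t`,
from `T` for the adjoint and from `0` for the state: this Volterra form is what Gronwall's
inequality needs. -/
theorem IsEvolution.abs_feedback_sub_le (hT : 0 ≤ T) (hC : IsSkewFamily C M) {α : ℝ} (hα : 0 < α)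
    {a a' b b' : ControlSpace T} {x₀ y y' : F} {X X' Y Y' : ℝ → F}
    (hX : IsEvolution C T a 0 x₀ X) (hX' : IsEvolution C T a' 0 x₀ X')
    (hY : IsEvolution C T b T y Y) (hY' : IsEvolution C T b' T y' Y') {S : ℝ} (hx : ‖x₀‖ ≤ S)
    (hy' : ‖y'‖ ≤ S) {t : ℝ} (ht : t ∈ Icc 0 T) :
    |feedback C α Y X t - feedback C α Y' X' t| ≤ α⁻¹ * M * S * (1 + 2 * M * S) *
      (‖y - y'‖ + |(∫ s in T..t, |(b - b') s|)| + |(∫ s in (0 : ℝ)..t, |(a - a') s|)|) := by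
  have h0 : (0 : ℝ) ∈ Icc 0 T := ⟨le_rfl, hT⟩
  have hTT : T ∈ Icc 0 T := ⟨hT, le_rfl⟩
  have hM := hC.nonneg
  have hS : 0 ≤ S := (norm_nonneg _).trans hx
  have h1 : ‖Y t - Y' t‖ ≤ ‖y - y'‖ + 2 * (M * S) * |(∫ s in T..t, |(b - b') s|)| :=
    (hY.norm_sub_le_integral hT hC hTT hY' ht).trans (by gcongr)
  have h2 : ‖X t - X' t‖ ≤ 2 * (M * S) * |(∫ s in (0 : ℝ)..t, |(a - a') s|)| := by
    have := hX.norm_sub_le_integral hT hC h0 hX' ht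
    rw [sub_self, norm_zero, zero_add] at this
    exact this.trans (by gcongr)
  have h3 : ‖X t‖ ≤ S := (hX.norm_le hT hC h0 ht).trans hx
  have h4 : ‖Y' t‖ ≤ S := (hY'.norm_le hT hC hTT ht).trans hy'
  rw [feedback, feedback, ← mul_sub, abs_mul, abs_of_pos (inv_pos.2 hα)]
  set I := |(∫ s in T..t, |(b - b') s|)|
  set I' := |(∫ s in (0 : ℝ)..t, |(a - a') s|)|
  have hI : 0 ≤ I := abs_nonneg _
  have hI' : 0 ≤ I' := abs_nonneg _
  have hα' : 0 ≤ α⁻¹ := (inv_pos.2 hα).le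
  have hn := norm_nonneg (y - y')
  calc _ ≤ α⁻¹ * (M * ((‖y - y'‖ + 2 * (M * S) * I) * S + S * (2 * (M * S) * I'))) := by
        gcongr
        refine (hC.abs_pairing_sub_le Y X Y' X' t).trans ?_
        gcongr
    _ = α⁻¹ * M * S * (‖y - y'‖ + 2 * M * S * I + 2 * M * S * I') := by ring
    _ ≤ α⁻¹ * M * S * ((1 + 2 * M * S) * (‖y - y'‖ + I + I')) := by
        refine mul_le_mul_of_nonneg_left ?_ (by positivity)
        have : 0 ≤ 2 * M * S * ‖y - y'‖ := by positivity
        linarith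
    _ = _ := by ring

theorem IsEvolution.abs_feedback_sub_le_norm (hT : 0 ≤ T) (hC : IsSkewFamily C M) {α : ℝ}
    (hα : 0 < α) {a a' b b' : ControlSpace T} {x₀ y y' : F} {X X' Y Y' : ℝ → F}
    (hX : IsEvolution C T a 0 x₀ X) (hX' : IsEvolution C T a' 0 x₀ X')
    (hY : IsEvolution C T b T y Y) (hY' : IsEvolution C T b' T y' Y') {S : ℝ} (hx : ‖x₀‖ ≤ S)
    (hy' : ‖y'‖ ≤ S) {t : ℝ} (ht : t ∈ Icc 0 T) :
    |feedback C α Y X t - feedback C α Y' X' t| ≤ α⁻¹ * M * S * (1 + 2 * M * S) *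
      (‖y - y'‖ + √T * ‖b - b'‖ + √T * ‖a - a'‖) := by
  have hM := hC.nonneg
  have hS : 0 ≤ S := (norm_nonneg _).trans hx
  have hα' : 0 ≤ α⁻¹ := (inv_pos.2 hα).le
  refine (hX.abs_feedback_sub_le hT hC hα hX' hY hY' hx hy' ht).trans ?_
  gcongr
  · exact (b - b').abs_integral_abs_le hT ⟨hT, le_rfl⟩ ht
  · exact (a - a').abs_integral_abs_le hT ⟨le_rfl, hT⟩ ht

theorem IsEvolution.norm_toControl_feedback_sub_le (hT : 0 ≤ T) (hC : IsSkewFamily C M) {α : ℝ}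
    (hα : 0 < α) {a a' b b' : ControlSpace T} {x₀ y y' : F} {X X' Y Y' : ℝ → F}
    (hX : IsEvolution C T a 0 x₀ X) (hX' : IsEvolution C T a' 0 x₀ X')
    (hY : IsEvolution C T b T y Y) (hY' : IsEvolution C T b' T y' Y') {S : ℝ} (hx : ‖x₀‖ ≤ S)
    (hy' : ‖y'‖ ≤ S) :
    ‖toControl T (feedback C α Y X) - toControl T (feedback C α Y' X')‖ ≤
      α⁻¹ * M * S * (1 + 2 * M * S) * (‖y - y'‖ + √T * ‖b - b'‖ + √T * ‖a - a'‖) * √T := by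
  have hM := hC.nonneg
  have hS : 0 ≤ S := (norm_nonneg _).trans hx
  have hα' : 0 ≤ α⁻¹ := (inv_pos.2 hα).le
  rw [ControlSpace.toControl_sub (hC.continuousOn_feedback α hY.1 hX.1)
    (hC.continuousOn_feedback α hY'.1 hX'.1)]
  exact ControlSpace.norm_toControl_le hT ((hC.continuousOn_feedback α hY.1 hX.1).sub
    (hC.continuousOn_feedback α hY'.1 hX'.1)) (by positivity) fun t ht =>
    hX.abs_feedback_sub_le_norm hT hC hα hX' hY hY' hx hy' ht

/-- Brings an implicit relaxation step, whose feedback depends on the difference `d` itself, to the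
hypothesis of `exists_gronwall`; the factor `2` bounds `c`. -/
theorem ControlSpace.ae_abs_le_of_eq {f g : ℝ → ℝ} (hf : ContinuousOn f (Icc 0 T))
    (hg : ContinuousOn g (Icc 0 T)) {d r : ControlSpace T} {c κ t₀ : ℝ} (hc : c ∈ Icc (0 : ℝ) 2)
    (hd : d = c • (toControl T f - toControl T g) + r)
    (hfg : ∀ t ∈ Icc 0 T, |f t - g t| ≤ κ * |(∫ s in t₀..t, |d s|)|) :
    ∀ᵐ t ∂((volume : Measure ℝ).restrict (Icc (0 : ℝ) T)),
      |d t| ≤ |r t| + 2 * κ * |(∫ s in t₀..t, |d s|)| := by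
  have hd' : d =ᵐ[(volume : Measure ℝ).restrict (Icc (0 : ℝ) T)]
      (c • (toControl T f - toControl T g) + r : ControlSpace T) := by rw [← hd]
  filter_upwards [hd', Lp.coeFn_add (c • (toControl T f - toControl T g)) r,
    Lp.coeFn_smul c (toControl T f - toControl T g), Lp.coeFn_sub (toControl T f) (toControl T g),
    toControl_ae hf, toControl_ae hg, ae_restrict_mem measurableSet_Icc] with t h1 h2 h3 h4 h5 h6 h7
  nth_rewrite 1 [h1]
  rw [h2, Pi.add_apply, h3, Pi.smul_apply, h4, Pi.sub_apply, h5, h6, smul_eq_mul, add_comm]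
  refine (abs_add_le _ _).trans (by
    gcongr
    rw [abs_mul, abs_of_nonneg hc.1, mul_assoc]
    exact mul_le_mul hc.2 (hfg t h7) (abs_nonneg _) zero_le_two)

/-- Exact increment of the quadratic final cost. -/
theorem IsEvolution.inner_apply_sub (hT : 0 ≤ T) (hC : IsSkewFamily C M) {Q : F →L[ℝ] F}
    (hQs : ∀ x y, (inner ℝ (Q x) y : ℝ) = inner ℝ x (Q y)) {α : ℝ} (hα : 0 < α)
    {a a' b : ControlSpace T} {x₀ : F} {X X' Y : ℝ → F} (hX : IsEvolution C T a 0 x₀ X)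
    (hX' : IsEvolution C T a' 0 x₀ X') (hY : IsEvolution C T b T (Q (X T)) Y) :
    (inner ℝ (X' T) (Q (X' T)) : ℝ) - inner ℝ (X T) (Q (X T))
      = inner ℝ (X' T - X T) (Q (X' T - X T))
        + α * (2 * inner ℝ (a' - b) (toControl T (feedback C α Y X'))
          + 2 * inner ℝ (b - a) (toControl T (feedback C α Y X))) := by
  have h0 : (0 : ℝ) ∈ Icc 0 T := ⟨le_rfl, hT⟩
  have hTT : T ∈ Icc 0 T := ⟨hT, le_rfl⟩
  -- `X` and `X'` start from the same `x₀`, so the terms at time `0` cancel between the two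
  -- dualities, leaving `⟨Q (X T), X' T - X T⟩`, half the linear part of the increment.
  have e1 := hX.inner_sub_inner hT hC h0 hTT hY
  have e2 := hX'.inner_sub_inner hT hC h0 hTT hY
  rw [hC.toControl_pairing hα hY.1 hX.1, real_inner_smul_right, hX.apply_self h0,
    hY.apply_self hTT] at e1
  rw [hC.toControl_pairing hα hY.1 hX'.1, real_inner_smul_right, hX'.apply_self h0,
    hY.apply_self hTT] at e2
  have e3 : (inner ℝ (b - a) (toControl T (feedback C α Y X)) : ℝ)
      = -inner ℝ (a - b) (toControl T (feedback C α Y X)) := by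
    rw [← inner_neg_left, neg_sub]
  rw [e3]
  simp only [map_sub, inner_sub_left, inner_sub_right]
  rw [inner_sub_left] at e1 e2
  rw [hQs] at e1 e2
  have e4 : (inner ℝ (X' T) (Q (X T)) : ℝ) = inner ℝ (X T) (Q (X' T)) := by
    rw [← hQs, real_inner_comm]
  rw [inner_sub_left] at *
  linarith

variable {Q : F →L[ℝ] F} {α δ η : ℝ} {x₀ : F} {a b : ℕ → ControlSpace T} {X Y : ℕ → ℝ → F}

namespace IsFeedbackScheme

theorem norm_apply_le (hT : 0 ≤ T) (hC : IsSkewFamily C M)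
    (hs : IsFeedbackScheme C Q T α δ η x₀ a b X Y) (k : ℕ) :
    ‖Q (X k T)‖ ≤ ‖x₀‖ + ‖Q‖ * ‖x₀‖ := by
  have h := (hs.state k).norm_le hT hC ⟨le_rfl, hT⟩ (t := T) ⟨hT, le_rfl⟩
  calc _ ≤ ‖Q‖ * ‖X k T‖ := Q.le_opNorm _
    _ ≤ ‖Q‖ * ‖x₀‖ := by gcongr
    _ ≤ _ := le_add_of_nonneg_left (norm_nonneg _)

theorem cost_increment (hT : 0 ≤ T) (hC : IsSkewFamily C M)
    (hQs : ∀ x y, (inner ℝ (Q x) y : ℝ) = inner ℝ x (Q y)) (hα : 0 < α)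
    (hs : IsFeedbackScheme C Q T α δ η x₀ a b X Y) (k : ℕ) :
    ((inner ℝ (X (k + 1) T) (Q (X (k + 1) T)) : ℝ) - α * ‖a (k + 1)‖ ^ 2)
      - (inner ℝ (X k T) (Q (X k T)) - α * ‖a k‖ ^ 2)
      = inner ℝ (X (k + 1) T - X k T) (Q (X (k + 1) T - X k T))
        + α * ((2 / δ - 1) * ‖a (k + 1) - b k‖ ^ 2)
        + α * ((2 / η - 1) * ‖b k - a k‖ ^ 2) := by
  have h := (hs.state k).inner_apply_sub hT hC hQs hα (hs.state (k + 1)) (hs.adjoint k)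
  rw [← two_inner_sub_sub_norm_sq (hs.forward k), ← two_inner_sub_sub_norm_sq (hs.backward k)]
  linarith

/-- Monotonicity: all contributions to the increment of the cost vanish in the limit, and the
controls stay bounded. -/
theorem tendsto_increment (hT : 0 ≤ T) (hC : IsSkewFamily C M)
    (hQs : ∀ x y, (inner ℝ (Q x) y : ℝ) = inner ℝ x (Q y)) (hQp : ∀ x, 0 ≤ (inner ℝ x (Q x) : ℝ))
    (hα : 0 < α) (hδ : δ ∈ Icc (0 : ℝ) 2) (hη : η ∈ Icc (0 : ℝ) 2)
    (hs : IsFeedbackScheme C Q T α δ η x₀ a b X Y) :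
    (∃ K, ∀ k, ‖a k‖ ≤ K) ∧
    Tendsto (fun k => ‖Q (X (k + 1) T) - Q (X k T)‖) atTop (𝓝 0) ∧
    Tendsto (fun k => (2 / δ - 1) * ‖a (k + 1) - b k‖ ^ 2) atTop (𝓝 0) ∧
    Tendsto (fun k => (2 / η - 1) * ‖b k - a k‖ ^ 2) atTop (𝓝 0) := by
  set J : ℕ → ℝ := fun k => inner ℝ (X k T) (Q (X k T)) - α * ‖a k‖ ^ 2 with hJ
  have hinc := fun k => hs.cost_increment hT hC hQs hα k
  have hnδ := fun k => coeff_mul_norm_sq_nonneg hδ (hs.forward k)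
  have hnη := fun k => coeff_mul_norm_sq_nonneg hη (hs.backward k)
  have hnQ := fun k => hQp (X (k + 1) T - X k T)
  have hmono : Monotone J := monotone_nat_of_le_succ fun k => by
    have h1 := mul_nonneg hα.le (hnδ k)
    have h2 := mul_nonneg hα.le (hnη k)
    have := hinc k
    simp only [hJ]
    linarith [hnQ k]
  have hXb : ∀ k, (inner ℝ (X k T) (Q (X k T)) : ℝ) ≤ ‖Q‖ * ‖x₀‖ ^ 2 := fun k => by
    have h := (hs.state k).norm_le hT hC ⟨le_rfl, hT⟩ (t := T) ⟨hT, le_rfl⟩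
    refine (real_inner_le_norm _ _).trans ?_
    calc _ ≤ ‖X k T‖ * (‖Q‖ * ‖X k T‖) := by gcongr; exact Q.le_opNorm _
      _ ≤ ‖x₀‖ * (‖Q‖ * ‖x₀‖) := by gcongr
      _ = _ := by ring
  have hbdd : BddAbove (range J) := by
    refine ⟨‖Q‖ * ‖x₀‖ ^ 2, ?_⟩
    rintro _ ⟨k, rfl⟩
    have : 0 ≤ α * ‖a k‖ ^ 2 := by positivity
    simp only [hJ]
    linarith [hXb k]
  have hlim := tendsto_atTop_ciSup hmono hbdd
  have hdiff : Tendsto (fun k => J (k + 1) - J k) atTop (𝓝 0) := by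
    simpa using (hlim.comp (tendsto_add_atTop_nat 1)).sub hlim
  -- The bound on the controls comes from `J 0 ≤ J k` and the bound `‖Q‖ ‖x₀‖²` on the final cost.
  refine ⟨⟨√((‖Q‖ * ‖x₀‖ ^ 2 - J 0) / α), fun k => ?_⟩, ?_, ?_, ?_⟩
  · refine Real.le_sqrt_of_sq_le ?_
    rw [le_div_iff₀ hα]
    have := hmono (Nat.zero_le k)
    simp only [hJ] at this ⊢
    linarith [hXb k]
  · have h1 : Tendsto (fun k => (‖Q‖ + 1) * (J (k + 1) - J k)) atTop (𝓝 0) := by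
      simpa using hdiff.const_mul (‖Q‖ + 1)
    have h2 : Tendsto (fun k => ‖Q (X (k + 1) T) - Q (X k T)‖ ^ 2) atTop (𝓝 0) := by
      refine squeeze_zero (fun k => sq_nonneg _) (fun k => ?_) h1
      rw [← map_sub]
      refine (norm_apply_sq_le_of_nonneg hQs hQp _).trans ?_
      gcongr
      have h1 := mul_nonneg hα.le (hnδ k)
      have h2 := mul_nonneg hα.le (hnη k)
      have := hinc k
      simp only [hJ]
      linarith
    simpa using h2.sqrt
  · refine squeeze_zero hnδ (fun k => ?_) (by simpa using hdiff.const_mul α⁻¹)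
    rw [le_inv_mul_iff₀ hα]
    have h2 := mul_nonneg hα.le (hnη k)
    have := hinc k
    simp only [hJ]
    linarith [hnQ k]
  · refine squeeze_zero hnη (fun k => ?_) (by simpa using hdiff.const_mul α⁻¹)
    rw [le_inv_mul_iff₀ hα]
    have h2 := mul_nonneg hα.le (hnδ k)
    have := hinc k
    simp only [hJ]
    linarith [hnQ k]

end IsFeedbackScheme

theorem tendsto_norm_of_coeff_mul_sq {c : ℝ} (hc : c ∈ Ioo (0 : ℝ) 2) {u : ℕ → ControlSpace T}
    (h : Tendsto (fun k => (2 / c - 1) * ‖u k‖ ^ 2) atTop (𝓝 0)) :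
    Tendsto (fun k => ‖u k‖) atTop (𝓝 0) := by
  have hp : 0 < 2 / c - 1 := by
    rw [sub_pos, lt_div_iff₀ hc.1]; linarith [hc.2]
  have h1 := (h.const_mul (2 / c - 1)⁻¹).sqrt
  simpa [inv_mul_cancel_left₀ hp.ne'] using h1

/-- At an endpoint, `0` or `2`, one has `|1 - c| = 1`, and the cost increment says nothing about
that half sweep; both cannot happen at once. -/
theorem mem_Ioo_or_mem_Ioo (hδ : δ ∈ Icc (0 : ℝ) 2) (hη : η ∈ Icc (0 : ℝ) 2)
    (hδη : |(1 - δ) * (1 - η)| < 1) : δ ∈ Ioo (0 : ℝ) 2 ∨ η ∈ Ioo (0 : ℝ) 2 := by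
  by_contra hcon
  push Not at hcon
  have h : ∀ c : ℝ, c ∈ Icc (0 : ℝ) 2 → c ∉ Ioo (0 : ℝ) 2 → |1 - c| = 1 := by
    intro c hc hc'
    rcases eq_or_lt_of_le hc.1 with rfl | h0
    · simp
    rcases eq_or_lt_of_le hc.2 with rfl | h2
    · norm_num
    exact absurd ⟨h0, h2⟩ hc'
  rw [abs_mul, h δ hδ hcon.1, h η hη hcon.2] at hδη
  norm_num at hδη

end Scheme

/-! ### Convergence in `L²`, criticality of the limit, uniform convergence -/

section Convergence

variable {F : Type*} [NormedAddCommGroup F] [InnerProductSpace ℝ F] [CompleteSpace F]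
  {C : ℝ → F →L[ℝ] F} {M T : ℝ} {Q : F →L[ℝ] F} {α δ η : ℝ} {x₀ : F}
  {a b : ℕ → ControlSpace T} {X Y Z : ℕ → ℝ → F}

/-- Successive controls get close to each other and to the feedback law of the exact adjoint
state `Z k` of `a k`. -/
theorem IsFeedbackScheme.tendsto_sub (hT : 0 ≤ T) (hC : IsSkewFamily C M)
    (hQs : ∀ x y, (inner ℝ (Q x) y : ℝ) = inner ℝ x (Q y)) (hQp : ∀ x, 0 ≤ (inner ℝ x (Q x) : ℝ))
    (hα : 0 < α) (hδ : δ ∈ Icc (0 : ℝ) 2) (hη : η ∈ Icc (0 : ℝ) 2)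
    (hδη : |(1 - δ) * (1 - η)| < 1) (hs : IsFeedbackScheme C Q T α δ η x₀ a b X Y)
    (hZ : ∀ k, IsEvolution C T (a k) T (Q (X k T)) (Z k)) :
    Tendsto (fun k => b k - a k) atTop (𝓝 0) ∧
    Tendsto (fun k => a (k + 1) - b k) atTop (𝓝 0) ∧
    Tendsto (fun k => toControl T (feedback C α (Z k) (X k)) - a k) atTop (𝓝 0) := by
  have hM := hC.nonneg
  have h0 : (0 : ℝ) ∈ Icc 0 T := ⟨le_rfl, hT⟩
  have hTT : T ∈ Icc 0 T := ⟨hT, le_rfl⟩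
  obtain ⟨-, hQX, hcδ, hcη⟩ := hs.tendsto_increment hT hC hQs hQp hα hδ hη
  set S := ‖x₀‖ + ‖Q‖ * ‖x₀‖ with hS
  have hxS : ‖x₀‖ ≤ S := le_add_of_nonneg_right (by positivity)
  have hyS := hs.norm_apply_le hT hC
  set κ := α⁻¹ * M * S * (1 + 2 * M * S) with hκ
  have hκ0 : 0 ≤ κ := by positivity
  set p : ℕ → ControlSpace T := fun k => toControl T (feedback C α (Y k) (X k)) with hp
  set q : ℕ → ControlSpace T := fun k => toControl T (feedback C α (Y k) (X (k + 1))) with hq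
  set P : ℕ → ControlSpace T := fun k => toControl T (feedback C α (Z k) (X k)) with hP
  have hba : ∀ k, b k - a k = η • (p k - a k) := hs.backward
  have hab : ∀ k, a (k + 1) - b k = δ • (q k - b k) := hs.forward
  have hfc : ∀ {V W : ℝ → F}, ContinuousOn V (Icc 0 T) → ContinuousOn W (Icc 0 T) →
    ContinuousOn (feedback C α V W) (Icc 0 T) := fun hV hW => hC.continuousOn_feedback α hV hW
  have hpP : ∀ k, ‖p k - P k‖ ≤ κ * (√T * ‖b k - a k‖) * √T := fun k => by
    simpa using (hs.state k).norm_toControl_feedback_sub_le hT hC hα (hs.state k) (hs.adjoint k)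
      (hZ k) hxS (hyS k)
  have hpP' : Tendsto (fun k => b k - a k) atTop (𝓝 0) →
      Tendsto (fun k => p k - P k) atTop (𝓝 0) := fun h => by
    have h1 := ((((tendsto_zero_iff_norm_tendsto_zero.1 h).const_mul √T).const_mul κ).mul_const √T)
    exact squeeze_zero_norm hpP (by simpa using h1)
  obtain ⟨K, hK⟩ := ControlSpace.exists_gronwall hT (κ := 2 * κ) (by positivity)
  have key : Tendsto (fun k => b k - a k) atTop (𝓝 0) ∧
      Tendsto (fun k => P k - a k) atTop (𝓝 0) := by
    rcases mem_Ioo_or_mem_Ioo hδ hη hδη with hδ' | hη'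
    · have h1 : Tendsto (fun k => a (k + 1) - b k) atTop (𝓝 0) :=
        tendsto_zero_iff_norm_tendsto_zero.2 (tendsto_norm_of_coeff_mul_sq hδ' hcδ)
      -- Both laws use the state `X (k + 1)`; only the adjoints differ, through their final data and
      -- the controls `b k` and `a (k + 1)`.
      have h2 : Tendsto (fun k => q k - P (k + 1)) atTop (𝓝 0) := by
        have e : ∀ k, ‖q k - P (k + 1)‖
            ≤ κ * (‖Q (X (k + 1) T) - Q (X k T)‖ + √T * ‖a (k + 1) - b k‖) * √T := fun k => by
          have := (hs.state (k + 1)).norm_toControl_feedback_sub_le hT hC hα (hs.state (k + 1))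
            (hs.adjoint k) (hZ (k + 1)) hxS (hyS (k + 1))
          rw [norm_sub_rev (Q _), norm_sub_rev (b k)] at this
          simpa using this
        refine squeeze_zero_norm e ?_
        simpa using ((hQX.add ((tendsto_zero_iff_norm_tendsto_zero.1 h1).const_mul √T)).const_mul
          κ).mul_const √T
      have h3 : Tendsto (fun k => P (k + 1) - a (k + 1)) atTop (𝓝 0) := by
        have e : ∀ k, P (k + 1) - a (k + 1)
            = -(q k - P (k + 1)) + δ⁻¹ • (a (k + 1) - b k) - (a (k + 1) - b k) := fun k => by
          nth_rewrite 1 [hab k]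
          rw [inv_smul_smul₀ hδ'.1.ne']
          abel
        simp_rw [e]
        simpa using (h2.neg.add (h1.const_smul δ⁻¹)).sub h1
      have h4 : Tendsto (fun k => P k - a k) atTop (𝓝 0) :=
        (tendsto_add_atTop_iff_nat (f := fun k => P k - a k) 1).1 h3
      refine ⟨?_, h4⟩
      -- Here `η` may be `0` or `2`, so the cost says nothing about `b k - a k`. It equals `η (p k -
      -- P k) + η (P k - a k)`, and the first term is of Volterra type in `b k - a k`: Gronwall
      -- backwards from `T`.
      have h5 : ∀ k, ‖b k - a k‖ ≤ K * ‖η • (P k - a k)‖ := fun k => by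
        refine hK T hTT _ _ (ControlSpace.ae_abs_le_of_eq (hfc (hs.adjoint k).1 (hs.state k).1)
          (hfc (hZ k).1 (hs.state k).1) hη ?_ fun t ht => ?_)
        · rw [hba k, ← smul_add, sub_add_sub_cancel]
        · have := (hs.state k).abs_feedback_sub_le hT hC hα (hs.state k) (hs.adjoint k) (hZ k) hxS
            (hyS k) ht
          rw [sub_self, norm_zero, zero_add, sub_self] at this
          refine this.trans (le_of_eq ?_)
          rw [ControlSpace.integral_abs_zero h0 ht, abs_zero, add_zero]
      refine squeeze_zero_norm h5 ?_
      simpa using (h4.const_smul η).norm.const_mul K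
    · have h1 : Tendsto (fun k => b k - a k) atTop (𝓝 0) :=
        tendsto_zero_iff_norm_tendsto_zero.2 (tendsto_norm_of_coeff_mul_sq hη' hcη)
      refine ⟨h1, ?_⟩
      have e : ∀ k, P k - a k = -(p k - P k) + η⁻¹ • (b k - a k) := fun k => by
        rw [hba k, inv_smul_smul₀ hη'.1.ne']
        abel
      simp_rw [e]
      simpa using (hpP' h1).neg.add (h1.const_smul η⁻¹)
  obtain ⟨hB, hPa⟩ := key
  refine ⟨hB, ?_, hPa⟩
  -- Remainder in `a (k + 1) - a k = δ (q k - p k) + r`; the term `q k - p k` is of Volterra type in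
  -- the left side, so Gronwall forwards from `0` applies.
  have hr : Tendsto (fun k => δ • (p k - b k) + (b k - a k)) atTop (𝓝 0) := by
    have e : ∀ k, δ • (p k - b k) + (b k - a k)
        = δ • ((p k - P k) + (P k - a k) - (b k - a k)) + (b k - a k) := fun k => by
      congr 2
      abel
    simp_rw [e]
    simpa using ((((hpP' hB).add hPa).sub hB).const_smul δ).add hB
  have hd : Tendsto (fun k => a (k + 1) - a k) atTop (𝓝 0) := by
    refine squeeze_zero_norm (fun k => hK 0 h0 _ _ (ControlSpace.ae_abs_le_of_eq
      (hfc (hs.adjoint k).1 (hs.state (k + 1)).1) (hfc (hs.adjoint k).1 (hs.state k).1) hδ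
      (r := δ • (p k - b k) + (b k - a k)) ?_ fun t ht => ?_))
      (by simpa using hr.norm.const_mul K)
    · rw [← add_assoc, ← smul_add, sub_add_sub_cancel, ← hab k, sub_add_sub_cancel]
    · have := (hs.state (k + 1)).abs_feedback_sub_le hT hC hα (hs.state k) (hs.adjoint k)
        (hs.adjoint k) hxS (hyS k) ht
      rw [sub_self, norm_zero, zero_add, sub_self] at this
      refine this.trans (le_of_eq ?_)
      rw [ControlSpace.integral_abs_zero hTT ht, abs_zero, zero_add]
  have e : ∀ k, a (k + 1) - b k = (a (k + 1) - a k) - (b k - a k) := fun k => by abel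
  simp_rw [e]
  simpa using hd.sub hB

/-- Weak limit points of the scheme are strong limit points and solve the optimality system. -/
theorem IsFeedbackScheme.tendsto_of_weaklyTendsto (hT : 0 ≤ T) (hC : IsSkewFamily C M)
    (hQs : ∀ x y, (inner ℝ (Q x) y : ℝ) = inner ℝ x (Q y)) (hQp : ∀ x, 0 ≤ (inner ℝ x (Q x) : ℝ))
    (hα : 0 < α) (hδ : δ ∈ Icc (0 : ℝ) 2) (hη : η ∈ Icc (0 : ℝ) 2)
    (hδη : |(1 - δ) * (1 - η)| < 1) (hs : IsFeedbackScheme C Q T α δ η x₀ a b X Y)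
    {k : ℕ → ℕ} (hk : Tendsto k atTop atTop) {e : ControlSpace T}
    (hweak : WeaklyTendsto (fun n => a (k n)) e ∨ WeaklyTendsto (fun n => b (k n)) e)
    {X₀ Y₀ : ℝ → F} (hX₀ : IsEvolution C T e 0 x₀ X₀)
    (hY₀ : IsEvolution C T e T (Q (X₀ T)) Y₀) :
    Tendsto (fun n => a (k n)) atTop (𝓝 e) ∧ Tendsto (fun n => b (k n)) atTop (𝓝 e) ∧
    Tendsto (fun n => X (k n) T) atTop (𝓝 (X₀ T)) ∧ e = toControl T (feedback C α Y₀ X₀) := by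
  have h0 : (0 : ℝ) ∈ Icc 0 T := ⟨le_rfl, hT⟩
  have hTT : T ∈ Icc 0 T := ⟨hT, le_rfl⟩
  have hM := hC.nonneg
  -- `Y k` is driven by `b k`; `Z k` is the adjoint driven by `a k` itself, so that state and
  -- adjoint have the same weakly convergent control.
  choose Z hZ using fun k => exists_isEvolution hT hC (a k) hTT (Q (X k T))
  obtain ⟨hB, -, hP⟩ := hs.tendsto_sub hT hC hQs hQp hα hδ hη hδη hZ
  obtain ⟨⟨K, hK⟩, -⟩ := hs.tendsto_increment hT hC hQs hQp hα hδ hη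
  have hBk := hB.comp hk
  have hw : WeaklyTendsto (fun n => a (k n)) e := by
    rcases hweak with h | h
    · exact h
    · intro g
      have h1 := (h g).sub ((tendsto_const_nhds (x := g)).inner (𝕜 := ℝ) hBk)
      simpa [inner_sub_right] using h1
  have hXt : ∀ t ∈ Icc 0 T, Tendsto (fun n => X (k n) t) atTop (𝓝 (X₀ t)) := fun t ht =>
    IsEvolution.tendsto_of_weaklyTendsto hT hC hw (fun n => hK (k n)) h0
      (tendsto_const_nhds (x := x₀)) (fun n => hs.state (k n)) hX₀ ht
  have hZt : ∀ t ∈ Icc 0 T, Tendsto (fun n => Z (k n) t) atTop (𝓝 (Y₀ t)) := fun t ht =>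
    IsEvolution.tendsto_of_weaklyTendsto hT hC hw (fun n => hK (k n)) hTT
      ((Q.continuous.tendsto _).comp (hXt T hTT)) (fun n => hZ (k n)) hY₀ ht
  set S := ‖x₀‖ + ‖Q‖ * ‖x₀‖ with hS
  have hSn : 0 ≤ S := by positivity
  have hxS : ‖x₀‖ ≤ S := le_add_of_nonneg_right (by positivity)
  have hfb : ∀ {V W : ℝ → F} {t : ℝ}, ‖V t‖ ≤ S → ‖W t‖ ≤ S →
      |feedback C α V W t| ≤ α⁻¹ * (S * (M * S)) := by
    intro V W t hV hW
    rw [feedback, abs_mul, abs_of_pos (inv_pos.2 hα), pairing]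
    have : 0 ≤ α⁻¹ := (inv_pos.2 hα).le
    gcongr
    refine (abs_real_inner_le_norm _ _).trans ?_
    gcongr
    exact (hC.bound _ _).trans (by gcongr)
  have hX₀T : ‖Q (X₀ T)‖ ≤ S := by
    refine le_of_tendsto ((Q.continuous.tendsto _).comp (hXt T hTT)).norm
      (Eventually.of_forall fun n => hs.norm_apply_le hT hC (k n))
  have hlim : Tendsto (fun n => toControl T (feedback C α (Z (k n)) (X (k n)))) atTop
      (𝓝 (toControl T (feedback C α Y₀ X₀))) := by
    rw [tendsto_iff_norm_sub_tendsto_zero]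
    have hc₀ := hC.continuousOn_feedback α hY₀.1 hX₀.1
    have hc := fun n => hC.continuousOn_feedback α (hZ (k n)).1 (hs.state (k n)).1
    simp_rw [fun n => ControlSpace.toControl_sub (hc n) hc₀]
    refine ControlSpace.tendsto_norm_toControl_zero (fun n => (hc n).sub hc₀)
      (K := α⁻¹ * (S * (M * S)) + α⁻¹ * (S * (M * S))) (fun n t ht => ?_) fun t ht => ?_
    · refine (abs_sub _ _).trans (add_le_add ?_ ?_)
      · exact hfb (((hZ (k n)).norm_le hT hC hTT ht).trans (hs.norm_apply_le hT hC _))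
          (((hs.state (k n)).norm_le hT hC h0 ht).trans hxS)
      · exact hfb ((hY₀.norm_le hT hC hTT ht).trans hX₀T) ((hX₀.norm_le hT hC h0 ht).trans hxS)
    · have h1 : Tendsto (fun n => feedback C α (Z (k n)) (X (k n)) t) atTop
          (𝓝 (feedback C α Y₀ X₀ t)) :=
        ((hZt t ht).inner (𝕜 := ℝ) (((C t).continuous.tendsto _).comp (hXt t ht))).const_mul _
      simpa using h1.sub_const (feedback C α Y₀ X₀ t)
  have hstrong : Tendsto (fun n => a (k n)) atTop (𝓝 (toControl T (feedback C α Y₀ X₀))) := by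
    simpa using hlim.sub (hP.comp hk)
  have he : e = toControl T (feedback C α Y₀ X₀) := by
    refine ext_inner_left ℝ fun g => ?_
    exact tendsto_nhds_unique (hw g) ((tendsto_const_nhds (x := g)).inner (𝕜 := ℝ) hstrong)
  rw [← he] at hstrong
  refine ⟨hstrong, ?_, hXt T hTT, he⟩
  simpa using hstrong.add hBk

/-- A control that satisfies the feedback law of its own state and adjoint state is critical. -/
theorem hasFDerivAt_zero_of_eq_feedback (hT : 0 ≤ T) (hC : IsSkewFamily C M)
    (hQs : ∀ x y, (inner ℝ (Q x) y : ℝ) = inner ℝ x (Q y)) (hα : 0 < α) {J : ControlSpace T → ℝ}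
    (hJ : ∀ (c : ControlSpace T) W, IsEvolution C T c 0 x₀ W →
      J c = inner ℝ (W T) (Q (W T)) - α * ‖c‖ ^ 2)
    {e : ControlSpace T} {X₀ Y₀ : ℝ → F} (hX₀ : IsEvolution C T e 0 x₀ X₀)
    (hY₀ : IsEvolution C T e T (Q (X₀ T)) Y₀) (he : e = toControl T (feedback C α Y₀ X₀)) :
    HasFDerivAt J (0 : ControlSpace T →L[ℝ] ℝ) e := by
  have h0 : (0 : ℝ) ∈ Icc 0 T := ⟨le_rfl, hT⟩
  have hTT : T ∈ Icc 0 T := ⟨hT, le_rfl⟩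
  have hM := hC.nonneg
  set S := ‖x₀‖ + ‖Q (X₀ T)‖ with hS
  have hxS : ‖x₀‖ ≤ S := le_add_of_nonneg_right (norm_nonneg _)
  have hyS : ‖Q (X₀ T)‖ ≤ S := le_add_of_nonneg_left (norm_nonneg _)
  set κ := α⁻¹ * M * S * (1 + 2 * M * S) with hκ
  set L := 2 * (M * ‖x₀‖) * √T with hL
  have hbound : ∀ c, ‖J c - J e‖ ≤ (L * (‖Q‖ * L) + 2 * α * (κ * √T * √T) + α) * ‖c - e‖ ^ 2 := by
    intro c
    obtain ⟨W, hW⟩ := exists_isEvolution hT hC c h0 x₀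
    -- With `b = a = e` one half sweep is trivial. Because `e` is its own feedback, the linear terms
    -- combine into `2 α ⟨c - e, q - e⟩`, which is quadratic since `q` is Lipschitz in the control.
    have h1 := hX₀.inner_apply_sub hT hC hQs hα hW hY₀
    rw [sub_self, inner_zero_left, mul_zero, add_zero] at h1
    set q : ControlSpace T := toControl T (feedback C α Y₀ W) with hq
    have hqe : ‖q - e‖ ≤ κ * √T * √T * ‖c - e‖ := by
      have := hW.norm_toControl_feedback_sub_le hT hC hα hX₀ hY₀ hY₀ hxS hyS
      rw [← he] at this
      refine this.trans (le_of_eq ?_)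
      simp only [sub_self, norm_zero, mul_zero, zero_add]
      ring
    have hWX : ‖W T - X₀ T‖ ≤ L * ‖c - e‖ := by
      have := hW.norm_sub_le hT hC h0 hX₀ hTT
      rw [sub_self, norm_zero, zero_add] at this
      refine this.trans (le_of_eq ?_)
      rw [hL]; ring
    have e1 : J c - J e = inner ℝ (W T - X₀ T) (Q (W T - X₀ T))
        + 2 * α * inner ℝ (c - e) (q - e) - α * ‖c - e‖ ^ 2 := by
      rw [hJ c W hW, hJ e X₀ hX₀]
      have e2 : ‖c‖ ^ 2 = ‖e‖ ^ 2 + 2 * inner ℝ (c - e) e + ‖c - e‖ ^ 2 := by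
        nth_rewrite 1 [← sub_add_cancel c e]
        rw [norm_add_sq_real]; ring
      rw [inner_sub_right, e2]
      linarith
    have e3 : |(inner ℝ (W T - X₀ T) (Q (W T - X₀ T)) : ℝ)| ≤ L * (‖Q‖ * L) * ‖c - e‖ ^ 2 := by
      refine (abs_real_inner_le_norm _ _).trans ?_
      have hL0 : 0 ≤ L := by positivity
      calc _ ≤ ‖W T - X₀ T‖ * (‖Q‖ * ‖W T - X₀ T‖) := by gcongr; exact Q.le_opNorm _
        _ ≤ (L * ‖c - e‖) * (‖Q‖ * (L * ‖c - e‖)) := by gcongr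
        _ = _ := by ring
    have e4 : |(inner ℝ (c - e) (q - e) : ℝ)| ≤ κ * √T * √T * ‖c - e‖ ^ 2 := by
      refine (abs_real_inner_le_norm _ _).trans ?_
      calc _ ≤ ‖c - e‖ * (κ * √T * √T * ‖c - e‖) := by gcongr
        _ = _ := by ring
    rw [e1, Real.norm_eq_abs]
    have e5 : |2 * α * inner ℝ (c - e) (q - e)| ≤ 2 * α * (κ * √T * √T * ‖c - e‖ ^ 2) := by
      rw [abs_mul, abs_of_pos (by positivity)]
      gcongr
    have e6 : 0 ≤ α * ‖c - e‖ ^ 2 := by positivity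
    rw [abs_le] at *
    constructor <;> linarith [e3.1, e3.2, e5.1, e5.2]
  have hO : (fun c => J c - J e) =O[𝓝 e] fun c => ‖c - e‖ ^ 2 :=
    Asymptotics.IsBigO.of_bound _ (Eventually.of_forall fun c => by
      simpa using hbound c)
  simpa using (hO.hasFDerivAt one_lt_two).add_const (J e)

/-- Once `ρ` is below `(1 - θ) ε / 2`, the excess of `m` over `ε / 2` is contracted by `θ` at each
step. -/
theorem tendsto_zero_of_le_mul_add {θ : ℝ} (hθ0 : 0 ≤ θ) (hθ : θ < 1) {m ρ : ℕ → ℝ}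
    (hm : ∀ k, 0 ≤ m k) (hρ : Tendsto ρ atTop (𝓝 0)) (h : ∀ k, m (k + 1) ≤ θ * m k + ρ k) :
    Tendsto m atTop (𝓝 0) := by
  rw [Metric.tendsto_atTop]
  intro ε hε
  obtain ⟨N, hN⟩ := (Metric.tendsto_atTop.1 hρ) ((1 - θ) * (ε / 2))
    (mul_pos (sub_pos.2 hθ) (half_pos hε))
  have h1 : ∀ j, m (N + j) - ε / 2 ≤ θ ^ j * m N := by
    intro j
    induction j with
    | zero => simpa using (half_pos hε).le
    | succ j ih =>
      have h2 := hN (N + j) (Nat.le_add_right _ _)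
      rw [Real.dist_eq, sub_zero] at h2
      have h3 := (le_abs_self _).trans h2.le
      have h4 := h (N + j)
      have h5 := mul_le_mul_of_nonneg_left ih hθ0
      rw [← add_assoc, pow_succ']
      nlinarith
  have h2 : Tendsto (fun j => θ ^ j * m N) atTop (𝓝 0) := by
    simpa using (tendsto_pow_atTop_nhds_zero_of_lt_one hθ0 hθ).mul_const (m N)
  obtain ⟨N', hN'⟩ := Metric.tendsto_atTop.1 h2 (ε / 2) (half_pos hε)
  refine ⟨N + N', fun n hn => ?_⟩
  obtain ⟨j, rfl⟩ := Nat.exists_eq_add_of_le ((Nat.le_add_right N N').trans hn)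
  have h3 := hN' j (by omega)
  rw [Real.dist_eq, sub_zero] at h3 ⊢
  rw [abs_of_nonneg (hm _)]
  linarith [h1 j, le_abs_self (θ ^ j * m N)]

theorem tendstoUniformlyOn_of_abs_sub_le {f : ℕ → ℝ → ℝ} {g : ℝ → ℝ} {S : Set ℝ} {c : ℕ → ℝ}
    (hc : Tendsto c atTop (𝓝 0)) (h : ∀ n, ∀ t ∈ S, |f n t - g t| ≤ c n) :
    TendstoUniformlyOn f g atTop S := by
  rw [Metric.tendstoUniformlyOn_iff]
  intro ε hε
  filter_upwards [hc.eventually_lt_const hε] with n hn t ht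
  rw [dist_comm, Real.dist_eq]
  exact (h n t ht).trans_lt hn

/-- If `a 0` is continuous, the scheme converges uniformly along the subsequence. -/
theorem IsFeedbackScheme.exists_tendstoUniformlyOn (hT : 0 ≤ T) (hC : IsSkewFamily C M)
    (hQs : ∀ x y, (inner ℝ (Q x) y : ℝ) = inner ℝ x (Q y)) (hQp : ∀ x, 0 ≤ (inner ℝ x (Q x) : ℝ))
    (hα : 0 < α) (hδ : δ ∈ Icc (0 : ℝ) 2) (hη : η ∈ Icc (0 : ℝ) 2)
    (hδη : |(1 - δ) * (1 - η)| < 1) (hs : IsFeedbackScheme C Q T α δ η x₀ a b X Y)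
    {k : ℕ → ℕ} (hk : Tendsto k atTop atTop) {e : ControlSpace T}
    (ha : Tendsto (fun n => a (k n)) atTop (𝓝 e))
    {X₀ Y₀ : ℝ → F} (hX₀ : IsEvolution C T e 0 x₀ X₀)
    (hY₀ : IsEvolution C T e T (Q (X₀ T)) Y₀)
    (hXT : Tendsto (fun n => X (k n) T) atTop (𝓝 (X₀ T)))
    (he : e = toControl T (feedback C α Y₀ X₀)) {f₀ : ℝ → ℝ} (hf₀ : IsContinuousRep (a 0) f₀) :
    ∃ (f f' : ℕ → ℝ → ℝ) (g : ℝ → ℝ),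
      (∀ j, IsContinuousRep (a j) (f j)) ∧ (∀ j, IsContinuousRep (b j) (f' j)) ∧
      IsContinuousRep e g ∧
      TendstoUniformlyOn (fun n => f (k n)) g atTop (Icc 0 T) ∧
      TendstoUniformlyOn (fun n => f' (k n)) g atTop (Icc 0 T) := by
  have h0 : (0 : ℝ) ∈ Icc 0 T := ⟨le_rfl, hT⟩
  have hTT : T ∈ Icc 0 T := ⟨hT, le_rfl⟩
  have hM := hC.nonneg
  choose Z hZ using fun k => exists_isEvolution hT hC (a k) hTT (Q (X k T))
  obtain ⟨hB, hA, -⟩ := hs.tendsto_sub hT hC hQs hQp hα hδ hη hδη hZ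
  obtain ⟨-, hQX, -⟩ := hs.tendsto_increment hT hC hQs hQp hα hδ hη
  set S := ‖x₀‖ + ‖Q‖ * ‖x₀‖ with hS
  have hxS : ‖x₀‖ ≤ S := le_add_of_nonneg_right (by positivity)
  have hyS := hs.norm_apply_le hT hC
  have hX₀T : ‖Q (X₀ T)‖ ≤ S :=
    le_of_tendsto ((Q.continuous.tendsto _).comp hXT).norm
      (Eventually.of_forall fun n => hyS (k n))
  set κ := α⁻¹ * M * S * (1 + 2 * M * S) with hκ
  have hκ0 : 0 ≤ κ := by positivity
  set p : ℕ → ℝ → ℝ := fun k => feedback C α (Y k) (X k) with hp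
  set q : ℕ → ℝ → ℝ := fun k => feedback C α (Y k) (X (k + 1)) with hq
  set P : ℕ → ℝ → ℝ := fun k => feedback C α (Z k) (X k) with hP
  have hpc : ∀ k, ContinuousOn (p k) (Icc 0 T) := fun k =>
    hC.continuousOn_feedback α (hs.adjoint k).1 (hs.state k).1
  have hqc : ∀ k, ContinuousOn (q k) (Icc 0 T) := fun k =>
    hC.continuousOn_feedback α (hs.adjoint k).1 (hs.state (k + 1)).1
  have hPc : ∀ k, ContinuousOn (P k) (Icc 0 T) := fun k =>
    hC.continuousOn_feedback α (hZ k).1 (hs.state k).1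
  -- Representatives generated by the update formulas themselves, so continuity propagates from `f₀`
  -- and the recursion holds at every `t`, not just almost everywhere.
  let f : ℕ → ℝ → ℝ := fun n => Nat.rec f₀ (fun k u t =>
    (u t + η * (p k t - u t)) + δ * (q k t - (u t + η * (p k t - u t)))) n
  let f' : ℕ → ℝ → ℝ := fun k t => f k t + η * (p k t - f k t)
  have hf0 : f 0 = f₀ := rfl
  have hfs : ∀ k t, f (k + 1) t = f' k t + δ * (q k t - f' k t) := fun _ _ => rfl
  have hrep : ∀ {u v : ControlSpace T} {r s : ℝ → ℝ} {c : ℝ}, IsContinuousRep u r →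
      ContinuousOn s (Icc 0 T) → v - u = c • (toControl T s - u) →
      IsContinuousRep v fun t => r t + c * (s t - r t) := by
    intro u v r s c hu hsc hv
    refine ⟨hu.1.add (continuousOn_const.mul (hsc.sub hu.1)), ?_⟩
    rw [sub_eq_iff_eq_add'] at hv
    rw [hv]
    filter_upwards [hu.2, toControl_ae hsc, Lp.coeFn_add u (c • (toControl T s - u)),
      Lp.coeFn_smul c (toControl T s - u), Lp.coeFn_sub (toControl T s) u] with t h1 h2 h3 h4 h5
    rw [h3, Pi.add_apply, h4, Pi.smul_apply, h5, Pi.sub_apply, h1, h2, smul_eq_mul]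
  have hf' : ∀ j, IsContinuousRep (a j) (f j) → IsContinuousRep (b j) (f' j) := fun j hj =>
    hrep hj (hpc j) (hs.backward j)
  have hf : ∀ j, IsContinuousRep (a j) (f j) := by
    intro j
    induction j with
    | zero => exact hf₀
    | succ j ih => exact hrep (hf' j ih) (hqc j) (hs.forward j)
  have hgc := hC.continuousOn_feedback α hY₀.1 hX₀.1
  have hg : IsContinuousRep e (feedback C α Y₀ X₀) := by
    refine ⟨hgc, ?_⟩
    conv_lhs => rw [he]
    exact toControl_ae hgc
  -- A common bound for `p k`, `q k` and `P k` against `P (k + 1)`; the repeated term is needed for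
  -- `P k`, whose state and adjoint are both driven by `a k`.
  set σ : ℕ → ℝ := fun k => κ * (‖Q (X (k + 1) T) - Q (X k T)‖ + √T * ‖a (k + 1) - b k‖
    + √T * ‖a (k + 1) - a k‖ + √T * ‖a (k + 1) - a k‖) with hσ
  have hAA : Tendsto (fun k => a (k + 1) - a k) atTop (𝓝 0) := by
    simpa using hA.add hB
  have hσ0 : Tendsto σ atTop (𝓝 0) := by
    have h1 := hAA.norm.const_mul √T
    simpa using (((hQX.add (hA.norm.const_mul √T)).add h1).add h1).const_mul κ
  have hpP1 : ∀ k, ∀ t ∈ Icc 0 T, |p k t - P (k + 1) t| ≤ σ k := fun k t ht => by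
    refine ((hs.state k).abs_feedback_sub_le_norm hT hC hα (hs.state (k + 1)) (hs.adjoint k)
      (hZ (k + 1)) hxS (hyS (k + 1)) ht).trans ?_
    rw [norm_sub_rev (Q _), norm_sub_rev (b k), norm_sub_rev (a k)]
    exact mul_le_mul_of_nonneg_left (le_add_of_nonneg_right (by positivity)) hκ0
  have hqP1 : ∀ k, ∀ t ∈ Icc 0 T, |q k t - P (k + 1) t| ≤ σ k := fun k t ht => by
    refine ((hs.state (k + 1)).abs_feedback_sub_le_norm hT hC hα (hs.state (k + 1)) (hs.adjoint k)
      (hZ (k + 1)) hxS (hyS (k + 1)) ht).trans ?_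
    rw [norm_sub_rev (Q _), norm_sub_rev (b k), sub_self, norm_zero, mul_zero, add_zero, hσ]
    refine mul_le_mul_of_nonneg_left ?_ hκ0
    rw [add_assoc _ (√T * _) (√T * _)]
    exact le_add_of_nonneg_right (by positivity)
  have hPP1 : ∀ k, ∀ t ∈ Icc 0 T, |P k t - P (k + 1) t| ≤ σ k := fun k t ht => by
    refine ((hs.state k).abs_feedback_sub_le_norm hT hC hα (hs.state (k + 1)) (hZ k)
      (hZ (k + 1)) hxS (hyS (k + 1)) ht).trans ?_
    rw [norm_sub_rev (Q _), norm_sub_rev (a k)]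
    refine mul_le_mul_of_nonneg_left ?_ hκ0
    have : 0 ≤ √T * ‖a (k + 1) - b k‖ := by positivity
    linarith
  set θ := |(1 - δ) * (1 - η)| with hθ
  obtain ⟨K, hK⟩ := isCompact_Icc.exists_bound_of_continuousOn ((hf 0).1.sub (hPc 0))
  let m : ℕ → ℝ := fun n => Nat.rec K (fun k u => θ * u + 5 * σ k) n
  have hms : ∀ k, m (k + 1) = θ * m k + 5 * σ k := fun _ => rfl
  have hfP : ∀ k, ∀ t ∈ Icc 0 T, |f k t - P k t| ≤ m k := by
    intro k
    induction k with
    | zero => exact hK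
    | succ k ih =>
      intro t ht
      -- One sweep is an affine combination of `f k`, `p k` and `q k` with weights `(1 - δ)(1 - η)`,
      -- `(1 - δ) η` and `δ` of sum `1`, so `P (k + 1)` can be subtracted inside. The errors total
      -- `(1 + 2 + 2) σ k`, whence the `5` in `m`.
      have e1 : f (k + 1) t - P (k + 1) t = (1 - δ) * (1 - η) * (f k t - P k t)
          + ((1 - δ) * (1 - η) * (P k t - P (k + 1) t)
          + ((1 - δ) * η * (p k t - P (k + 1) t) + δ * (q k t - P (k + 1) t))) := by
        rw [hfs]
        simp only [f']
        ring
      have h1 : |1 - δ| ≤ 1 := abs_le.2 ⟨by linarith [hδ.2], by linarith [hδ.1]⟩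
      have h2 : |(1 - δ) * η| ≤ 2 := by
        rw [abs_mul, abs_of_nonneg hη.1]
        calc _ ≤ 1 * 2 := mul_le_mul h1 hη.2 hη.1 zero_le_one
          _ = 2 := one_mul _
      have h3 : |δ| ≤ 2 := by rw [abs_of_nonneg hδ.1]; exact hδ.2
      have g1 : |(1 - δ) * (1 - η) * (f k t - P k t)| ≤ θ * m k := by
        rw [abs_mul]; exact mul_le_mul_of_nonneg_left (ih t ht) (abs_nonneg _)
      have g2 : |(1 - δ) * (1 - η) * (P k t - P (k + 1) t)| ≤ 1 * σ k := by
        rw [abs_mul]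
        exact mul_le_mul hδη.le (hPP1 k t ht) (abs_nonneg _) zero_le_one
      have g3 : |(1 - δ) * η * (p k t - P (k + 1) t)| ≤ 2 * σ k := by
        rw [abs_mul]
        exact mul_le_mul h2 (hpP1 k t ht) (abs_nonneg _) zero_le_two
      have g4 : |δ * (q k t - P (k + 1) t)| ≤ 2 * σ k := by
        rw [abs_mul]
        exact mul_le_mul h3 (hqP1 k t ht) (abs_nonneg _) zero_le_two
      rw [e1, hms]
      refine (abs_add_le _ _).trans ((add_le_add_right ((abs_add_le _ _).trans
        (add_le_add_right (abs_add_le _ _) _)) _).trans ?_)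
      linarith
  have hm0 : Tendsto m atTop (𝓝 0) :=
    tendsto_zero_of_le_mul_add (abs_nonneg _) hδη
      (fun k => (abs_nonneg _).trans (hfP k 0 h0)) (by simpa using hσ0.const_mul 5)
      fun k => (hms k).le
  set ρ : ℕ → ℝ := fun n => κ * (‖Q (X (k n) T) - Q (X₀ T)‖ + √T * ‖a (k n) - e‖
    + √T * ‖a (k n) - e‖) with hρ
  have hρ0 : Tendsto ρ atTop (𝓝 0) := by
    have h1 := (tendsto_iff_norm_sub_tendsto_zero.1 ha).const_mul √T
    have h2 := tendsto_iff_norm_sub_tendsto_zero.1 ((Q.continuous.tendsto _).comp hXT)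
    simpa using ((h2.add h1).add h1).const_mul κ
  have hPg : ∀ n, ∀ t ∈ Icc 0 T, |P (k n) t - feedback C α Y₀ X₀ t| ≤ ρ n := fun n t ht =>
    (hs.state (k n)).abs_feedback_sub_le_norm hT hC hα hX₀ (hZ (k n)) hY₀ hxS hX₀T ht
  have hfg : ∀ n, ∀ t ∈ Icc 0 T, |f (k n) t - feedback C α Y₀ X₀ t| ≤ m (k n) + ρ n :=
    fun n t ht => (abs_sub_le _ (P (k n) t) _).trans (add_le_add (hfP _ t ht) (hPg n t ht))
  have hmk := hm0.comp hk
  have hfu := hmk.add hρ0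
  have hBk := (hB.comp hk).norm
  refine ⟨f, f', feedback C α Y₀ X₀, hf, fun j => hf' j (hf j), hg,
    tendstoUniformlyOn_of_abs_sub_le (by simpa using hfu) hfg,
    tendstoUniformlyOn_of_abs_sub_le
      (c := fun n => (m (k n) + ρ n) + 2 * (κ * (√T * ‖b (k n) - a (k n)‖) + m (k n))) ?_ ?_⟩
  · simpa using hfu.add ((((hBk.const_mul √T).const_mul κ).add hmk).const_mul 2)
  · intro n t ht
    have e1 : f' (k n) t - feedback C α Y₀ X₀ t = (f (k n) t - feedback C α Y₀ X₀ t)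
        + η * (p (k n) t - f (k n) t) := by
      simp only [f']; ring
    have h1 : |p (k n) t - P (k n) t| ≤ κ * (√T * ‖b (k n) - a (k n)‖) := by
      simpa using (hs.state (k n)).abs_feedback_sub_le_norm hT hC hα (hs.state (k n))
        (hs.adjoint (k n)) (hZ (k n)) hxS (hyS (k n)) ht
    have h2 := hfP (k n) t ht
    rw [abs_sub_comm] at h2
    have h3 := (abs_sub_le (p (k n) t) (P (k n) t) (f (k n) t)).trans (add_le_add h1 h2)
    rw [e1]
    refine (abs_add_le _ _).trans (add_le_add (hfg n t ht) ?_)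
    rw [abs_mul, abs_of_nonneg hη.1]
    exact mul_le_mul hη.2 h3 (abs_nonneg _) zero_le_two

end Convergence

/-! ### The interaction picture: from the Schrödinger equation to a bounded skew evolution -/

section InteractionPicture

attribute [local instance] InnerProductSpace.complexToReal

variable {E : Type*} [NormedAddCommGroup E] [InnerProductSpace ℂ E] {H : E →ₗ.[ℂ] E}
  {U : ℝ → E →L[ℂ] E}

namespace IsSchrodingerGroup

theorem apply_apply (hU : IsSchrodingerGroup H U) (s t : ℝ) (v : E) :
    U s (U t v) = U (s + t) v := by
  rw [hU.map_add]; rfl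

theorem apply_neg_apply (hU : IsSchrodingerGroup H U) (t : ℝ) (v : E) : U t (U (-t) v) = v := by
  rw [hU.apply_apply, add_neg_cancel, hU.map_zero]; rfl

theorem neg_apply_apply (hU : IsSchrodingerGroup H U) (t : ℝ) (v : E) : U (-t) (U t v) = v := by
  rw [hU.apply_apply, neg_add_cancel, hU.map_zero]; rfl

theorem inner_map_map (hU : IsSchrodingerGroup H U) (t : ℝ) (v w : E) :
    inner ℂ (U t v) (U t w) = inner ℂ v w :=
  LinearIsometry.inner_map_map ⟨(U t).toLinearMap, hU.norm_map t⟩ v w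

theorem inner_neg_left (hU : IsSchrodingerGroup H U) (t : ℝ) (v w : E) :
    inner ℂ (U (-t) v) w = inner ℂ v (U t w) := by
  rw [← hU.inner_map_map t, hU.apply_neg_apply]

theorem inner_neg_right (hU : IsSchrodingerGroup H U) (t : ℝ) (v w : E) :
    inner ℂ v (U (-t) w) = inner ℂ (U t v) w := by
  rw [← hU.inner_map_map t, hU.apply_neg_apply]

theorem continuous_uncurry (hU : IsSchrodingerGroup H U) :
    Continuous fun p : ℝ × E => U p.1 p.2 := by
  refine continuous_iff_continuousAt.2 fun p => ?_
  refine tendsto_iff_norm_sub_tendsto_zero.2 ?_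
  have h1 : Tendsto (fun r : ℝ × E => ‖r.2 - p.2‖ + ‖U r.1 p.2 - U p.1 p.2‖) (𝓝 p) (𝓝 0) := by
    have h : Continuous fun r : ℝ × E => ‖r.2 - p.2‖ + ‖U r.1 p.2 - U p.1 p.2‖ :=
      (continuous_snd.sub continuous_const).norm.add
        (((hU.continuous p.2).comp continuous_fst).sub continuous_const).norm
    simpa using h.tendsto p
  refine squeeze_zero (fun _ => norm_nonneg _) (fun r => ?_) h1
  have e : U r.1 r.2 - U p.1 p.2 = U r.1 (r.2 - p.2) + (U r.1 p.2 - U p.1 p.2) := by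
    rw [map_sub]; abel
  rw [e]
  exact (norm_add_le _ _).trans (by rw [hU.norm_map])

theorem continuousOn_apply (hU : IsSchrodingerGroup H U) {τ : ℝ → ℝ} {g : ℝ → E} {S : Set ℝ}
    (hτ : ContinuousOn τ S) (hg : ContinuousOn g S) : ContinuousOn (fun s => U (τ s) (g s)) S :=
  hU.continuous_uncurry.comp_continuousOn (hτ.prodMk hg)

end IsSchrodingerGroup

/-- The generator `i U(-t) μ U(t)` of the evolution in the interaction picture. -/
noncomputable def interaction (U : ℝ → E →L[ℂ] E) (μ : E →L[ℂ] E) (s : ℝ) : E →L[ℝ] E :=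
  (Complex.I • (U (-s) * μ * U s)).restrictScalars ℝ

theorem interaction_apply (U : ℝ → E →L[ℂ] E) (μ : E →L[ℂ] E) (s : ℝ) (v : E) :
    interaction U μ s v = Complex.I • U (-s) (μ (U s v)) := rfl

/-- The target operator `U(-T) O U(T)` in the interaction picture. -/
noncomputable def interactionTarget (U : ℝ → E →L[ℂ] E) (O : E →L[ℂ] E) (T : ℝ) : E →L[ℝ] E :=
  (U (-T) * O * U T).restrictScalars ℝ

theorem interactionTarget_apply (U : ℝ → E →L[ℂ] E) (O : E →L[ℂ] E) (T : ℝ) (v : E) :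
    interactionTarget U O T v = U (-T) (O (U T v)) := rfl

theorem interactionTarget_inner_symm [CompleteSpace E] (hU : IsSchrodingerGroup H U)
    {O : E →L[ℂ] E} (hO : O.IsPositive) (T : ℝ) (x y : E) :
    (inner ℝ (interactionTarget U O T x) y : ℝ) = inner ℝ x (interactionTarget U O T y) := by
  have h : inner ℂ (U (-T) (O (U T x))) y = inner ℂ x (U (-T) (O (U T y))) := by
    rw [hU.inner_neg_left, hU.inner_neg_right]
    exact hO.isSelfAdjoint.isSymmetric _ _
  rw [real_inner_eq_re_inner ℂ, real_inner_eq_re_inner ℂ, interactionTarget_apply,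
    interactionTarget_apply, h]

theorem interactionTarget_inner_nonneg (hU : IsSchrodingerGroup H U)
    {O : E →L[ℂ] E} (hO : O.IsPositive) (T : ℝ) (x : E) :
    0 ≤ (inner ℝ x (interactionTarget U O T x) : ℝ) := by
  rw [real_inner_eq_re_inner ℂ, interactionTarget_apply, hU.inner_neg_right]
  exact hO.re_inner_nonneg_right _

/-- Conjugation by a unitary keeps `μ` self-adjoint and the factor `i` makes it skew for the real
part of the inner product. Continuity is claimed only strongly, as it is for `U`. -/
theorem IsSchrodingerGroup.isSkewFamily [CompleteSpace E] (hU : IsSchrodingerGroup H U)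
    {μ : E →L[ℂ] E} (hμ : IsSelfAdjoint μ) : IsSkewFamily (interaction U μ) ‖μ‖ where
  nonneg := norm_nonneg _
  bound s x := by
    rw [interaction_apply, norm_smul, Complex.norm_I, one_mul, hU.norm_map]
    exact (μ.le_opNorm _).trans (by rw [hU.norm_map])
  continuous x := by
    simp_rw [interaction_apply]
    exact (hU.continuous_uncurry.comp
      (continuous_neg.prodMk (μ.continuous.comp (hU.continuous x)))).const_smul _
  skew s x y := by
    have h : inner ℂ (U (-s) (μ (U s x))) y = inner ℂ x (U (-s) (μ (U s y))) := by
      rw [hU.inner_neg_left, hU.inner_neg_right]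
      exact hμ.isSymmetric _ _
    rw [real_inner_eq_re_inner ℂ, real_inner_eq_re_inner ℂ, interaction_apply, interaction_apply,
      inner_smul_left, inner_smul_right, h]
    simp

/-- The unitaries cancel and `Re (i z) = -Im z`. -/
theorem IsSchrodingerGroup.pairing_interaction (hU : IsSchrodingerGroup H U) (μ : E →L[ℂ] E)
    (χ ψ : ℝ → E) (t : ℝ) :
    pairing (interaction U μ) (fun t => U (-t) (χ t)) (fun t => U (-t) (ψ t)) t
      = -(inner ℂ (χ t) (μ (ψ t))).im := by
  rw [pairing, real_inner_eq_re_inner ℂ, interaction_apply, inner_smul_right, hU.inner_map_map,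
    hU.apply_neg_apply]
  simp

variable [CompleteSpace E] {μ : E →L[ℂ] E} {T : ℝ}

/-- Applying a unitary `U(r)` to the integral term of a mild solution. -/
theorem IsSchrodingerGroup.apply_integral (hU : IsSchrodingerGroup H U) (hT : 0 ≤ T)
    (ε : ControlSpace T) {φ : ℝ → E} (hφ : ContinuousOn φ (Icc 0 T)) {t₀ t : ℝ}
    (ht₀ : t₀ ∈ Icc 0 T) (ht : t ∈ Icc 0 T) :
    U (-t) (∫ s in t₀..t, (Complex.I * (ε s : ℂ)) • U (t - s) (μ (φ s)))
      = ∫ s in t₀..t, ε s • interaction U μ s (U (-s) (φ s)) := by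
  have hc : ContinuousOn (fun s => U (t - s) (μ (φ s))) (uIcc 0 T) := by
    rw [uIcc_of_le hT]
    exact hU.continuousOn_apply (by fun_prop) (μ.continuous.comp_continuousOn hφ)
  have hε : IntervalIntegrable (fun s => Complex.I * (ε s : ℂ)) volume 0 T := by
    have h := ε.intervalIntegrable hT
    rw [intervalIntegrable_iff] at h ⊢
    exact h.ofReal.const_mul _
  have hi := (hε.smul_continuousOn hc).mono_Icc hT ht₀ ht
  rw [← (U (-t)).intervalIntegral_comp_comm hi]
  refine intervalIntegral.integral_congr fun s _ => ?_
  rw [map_smul, hU.apply_apply, interaction_apply, hU.apply_neg_apply, neg_add_eq_sub,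
    sub_sub_cancel_left, mul_comm, mul_smul, Complex.coe_smul]

theorem IsMildSolution.isEvolution (hU : IsSchrodingerGroup H U) (hT : 0 ≤ T)
    {ε : ControlSpace T} {t₀ : ℝ} (ht₀ : t₀ ∈ Icc 0 T) {φ₀ : E} {φ : ℝ → E}
    (hφ : IsMildSolution U μ T ε t₀ φ₀ φ) :
    IsEvolution (interaction U μ) T ε t₀ (U (-t₀) φ₀) fun t => U (-t) (φ t) := by
  refine ⟨hU.continuousOn_apply (by fun_prop) hφ.1, fun t ht => ?_⟩
  simp only
  nth_rewrite 1 [hφ.2 t ht]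
  rw [map_add, hU.apply_apply, hU.apply_integral hT ε hφ.1 ht₀ ht]
  congr 3
  ring

theorem IsEvolution.isMildSolution (hU : IsSchrodingerGroup H U) (hT : 0 ≤ T)
    {ε : ControlSpace T} {t₀ : ℝ} (ht₀ : t₀ ∈ Icc 0 T) {φ₀ : E} {X : ℝ → E}
    (hX : IsEvolution (interaction U μ) T ε t₀ (U (-t₀) φ₀) X) :
    IsMildSolution U μ T ε t₀ φ₀ fun t => U t (X t) := by
  have hc : ContinuousOn (fun t => U t (X t)) (Icc 0 T) :=
    hU.continuousOn_apply continuousOn_id hX.1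
  refine ⟨hc, fun t ht => ?_⟩
  have h := hU.apply_integral (μ := μ) hT ε hc ht₀ ht
  simp_rw [hU.neg_apply_apply] at h
  rw [← hU.apply_neg_apply t (∫ s in t₀..t, _), h]
  beta_reduce
  rw [hX.2 t ht, map_add, hU.apply_apply, ← sub_eq_add_neg]

theorem exists_isMildSolution (hU : IsSchrodingerGroup H U) (hμ : IsSelfAdjoint μ) (hT : 0 ≤ T)
    (ε : ControlSpace T) {t₀ : ℝ} (ht₀ : t₀ ∈ Icc 0 T) (φ₀ : E) :
    ∃ φ, IsMildSolution U μ T ε t₀ φ₀ φ := by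
  obtain ⟨X, hX⟩ := exists_isEvolution hT (hU.isSkewFamily hμ) ε ht₀ (U (-t₀) φ₀)
  exact ⟨_, hX.isMildSolution hU hT ht₀⟩

/-- The state chosen by `Classical.epsilon` is a genuine solution by existence, and its value at `T`
is determined by uniqueness. -/
theorem costFunctional_eq (hU : IsSchrodingerGroup H U) (hμ : IsSelfAdjoint μ) (hT : 0 ≤ T)
    (O : E →L[ℂ] E) (α : ℝ) (ψ₀ : E) (ε : ControlSpace T) {W : ℝ → E}
    (hW : IsEvolution (interaction U μ) T ε 0 (U (-0) ψ₀) W) :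
    costFunctional U μ O T α ψ₀ ε
      = inner ℝ (W T) (interactionTarget U O T (W T)) - α * ‖ε‖ ^ 2 := by
  have h0 : (0 : ℝ) ∈ Icc 0 T := ⟨le_rfl, hT⟩
  have hψ : IsMildSolution U μ T ε 0 ψ₀ (controlledState U μ T ψ₀ ε) :=
    Classical.epsilon_spec (exists_isMildSolution hU hμ hT ε h0 ψ₀)
  have hWT : W T = U (-T) (controlledState U μ T ψ₀ ε T) :=
    hW.eq hT (hU.isSkewFamily hμ) h0 (hψ.isEvolution hU hT h0) ⟨hT, le_rfl⟩
  rw [costFunctional, hWT, interactionTarget_apply, hU.apply_neg_apply, real_inner_eq_re_inner ℂ,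
    hU.inner_map_map, ControlSpace.norm_sq_eq, intervalIntegral.integral_of_le hT,
    integral_Icc_eq_integral_Ioc]
  rfl

theorem IsSchrodingerGroup.sub_eq_smul_toControl (hU : IsSchrodingerGroup H U)
    (hμ : IsSelfAdjoint μ) {χ ψ : ℝ → E} (hχ : ContinuousOn χ (Icc 0 T))
    (hψ : ContinuousOn ψ (Icc 0 T)) {u v : ControlSpace T} {c α : ℝ}
    (h : ∀ᵐ t ∂((volume : Measure ℝ).restrict (Icc (0 : ℝ) T)),
      v t = (1 - c) * u t - c / α * (inner ℂ (χ t) (μ (ψ t))).im) :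
    v - u = c • (toControl T (feedback (interaction U μ) α (fun t => U (-t) (χ t))
      fun t => U (-t) (ψ t)) - u) := by
  set f := feedback (interaction U μ) α (fun t => U (-t) (χ t)) fun t => U (-t) (ψ t) with hf
  have hfc : ContinuousOn f (Icc 0 T) := (hU.isSkewFamily hμ).continuousOn_feedback α
    (hU.continuousOn_apply (by fun_prop) hχ) (hU.continuousOn_apply (by fun_prop) hψ)
  refine Lp.ext ?_
  filter_upwards [h, toControl_ae hfc, Lp.coeFn_sub v u, Lp.coeFn_smul c (toControl T f - u),
    Lp.coeFn_sub (toControl T f) u] with t h1 h2 h3 h4 h5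
  rw [h3, Pi.sub_apply, h1, h4, Pi.smul_apply, h5, Pi.sub_apply, h2, hf, feedback,
    hU.pairing_interaction, smul_eq_mul]
  ring

theorem IsMonotonicScheme.isFeedbackScheme (hU : IsSchrodingerGroup H U) (hμ : IsSelfAdjoint μ)
    (hT : 0 ≤ T) {O : E →L[ℂ] E} {α δ η : ℝ} {ψ₀ : E} {ε ε' : ℕ → ControlSpace T}
    {ψ χ : ℕ → ℝ → E} (hs : IsMonotonicScheme U μ O T α δ η ψ₀ ε ε' ψ χ) :
    IsFeedbackScheme (interaction U μ) (interactionTarget U O T) T α δ η (U (-0) ψ₀) ε ε'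
      (fun k t => U (-t) (ψ k t)) fun k t => U (-t) (χ k t) where
  state k := (hs.state k).isEvolution hU hT ⟨le_rfl, hT⟩
  adjoint k := by
    have h := (hs.adjoint k).isEvolution hU hT ⟨hT, le_rfl⟩
    rwa [interactionTarget_apply, hU.apply_neg_apply]
  backward k := hU.sub_eq_smul_toControl hμ (hs.adjoint k).1 (hs.state k).1 (hs.control' k)
  forward k := hU.sub_eq_smul_toControl hμ (hs.adjoint k).1 (hs.state (k + 1)).1 (hs.control k)

theorem solvesEulerLagrange_of_eq_feedback (hU : IsSchrodingerGroup H U) (hμ : IsSelfAdjoint μ)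
    (hT : 0 ≤ T) {O : E →L[ℂ] E} {α : ℝ} (hα : 0 < α) {ψ₀ : E} {e : ControlSpace T}
    {X₀ Y₀ : ℝ → E} (hX₀ : IsEvolution (interaction U μ) T e 0 (U (-0) ψ₀) X₀)
    (hY₀ : IsEvolution (interaction U μ) T e T (interactionTarget U O T (X₀ T)) Y₀)
    (he : e = toControl T (feedback (interaction U μ) α Y₀ X₀)) :
    SolvesEulerLagrange U μ O T α ψ₀ e := by
  refine ⟨fun t => U t (X₀ t), fun t => U t (Y₀ t), hX₀.isMildSolution hU hT ⟨le_rfl, hT⟩,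
    IsEvolution.isMildSolution hU hT ⟨hT, le_rfl⟩ hY₀, ?_⟩
  have hc := (hU.isSkewFamily hμ).continuousOn_feedback α hY₀.1 hX₀.1
  have he' : e =ᵐ[(volume : Measure ℝ).restrict (Icc (0 : ℝ) T)]
      feedback (interaction U μ) α Y₀ X₀ := by
    conv_lhs => rw [he]
    exact toControl_ae hc
  filter_upwards [he'] with t ht
  have h := hU.pairing_interaction μ (fun t => U t (Y₀ t)) (fun t => U t (X₀ t)) t
  simp_rw [hU.neg_apply_apply] at h
  rw [ht, feedback, mul_inv_cancel_left₀ hα.ne', ← h]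

end InteractionPicture

/-! ### Transfer of the abstract results to the Schrödinger equation -/

theorem mainTheorem3
    {E : Type*} [NormedAddCommGroup E] [InnerProductSpace ℂ E] [CompleteSpace E]
    (H : E →ₗ.[ℂ] E) (U : ℝ → E →L[ℂ] E) (hU : IsSchrodingerGroup H U)
    (μ O : E →L[ℂ] E) (hμ : IsSelfAdjoint μ) (hO : O.IsPositive) (ψ₀ : E)
    (T α δ η : ℝ) (hT : 0 < T) (hα : 0 < α)
    (hδ : δ ∈ Icc (0 : ℝ) 2) (hη : η ∈ Icc (0 : ℝ) 2) (hδη : |(1 - δ) * (1 - η)| < 1)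
    (ε ε' : ℕ → ControlSpace T) (ψ χ : ℕ → ℝ → E)
    (hscheme : IsMonotonicScheme U μ O T α δ η ψ₀ ε ε' ψ χ)
    (k : ℕ → ℕ) (hk : StrictMono k) (e : ControlSpace T)
    (hweak : WeaklyTendsto (fun n => ε (k n)) e ∨ WeaklyTendsto (fun n => ε' (k n)) e) :
    -- strong convergence in `L²([0,T]; ℝ)`
    Tendsto (fun n => ε (k n)) atTop (𝓝 e) ∧
    Tendsto (fun n => ε' (k n)) atTop (𝓝 e) ∧
    -- the limit is a critical point of `J` and solves the Euler–Lagrange system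
    HasFDerivAt (costFunctional U μ O T α ψ₀) (0 : ControlSpace T →L[ℝ] ℝ) e ∧
    SolvesEulerLagrange U μ O T α ψ₀ e ∧
    -- for a continuous initial guess, strong convergence in `C([0,T]; ℝ)`
    ((∃ f₀, IsContinuousRep (ε 0) f₀) →
      ∃ (f f' : ℕ → ℝ → ℝ) (g : ℝ → ℝ),
        (∀ j, IsContinuousRep (ε j) (f j)) ∧
        (∀ j, IsContinuousRep (ε' j) (f' j)) ∧
        IsContinuousRep e g ∧
        TendstoUniformlyOn (fun n => f (k n)) g atTop (Icc 0 T) ∧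
        TendstoUniformlyOn (fun n => f' (k n)) g atTop (Icc 0 T)) := by
  let _ : InnerProductSpace ℝ E := InnerProductSpace.complexToReal
  have hT0 := hT.le
  have hC := hU.isSkewFamily hμ
  have hs := hscheme.isFeedbackScheme hU hμ hT0
  have hQs := interactionTarget_inner_symm hU hO T
  have hQp := interactionTarget_inner_nonneg hU hO T
  obtain ⟨X₀, hX₀⟩ := exists_isEvolution hT0 hC e ⟨le_rfl, hT0⟩ (U (-0) ψ₀)
  obtain ⟨Y₀, hY₀⟩ := exists_isEvolution hT0 hC e ⟨hT0, le_rfl⟩ (interactionTarget U O T (X₀ T))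
  obtain ⟨h1, h2, h3, h4⟩ := hs.tendsto_of_weaklyTendsto hT0 hC hQs hQp hα hδ hη hδη
    hk.tendsto_atTop hweak hX₀ hY₀
  exact ⟨h1, h2,
    hasFDerivAt_zero_of_eq_feedback hT0 hC hQs hα
      (fun c _ hW => costFunctional_eq hU hμ hT0 O α ψ₀ c hW) hX₀ hY₀ h4,
    solvesEulerLagrange_of_eq_feedback hU hμ hT0 hα hX₀ hY₀ h4,
    fun ⟨_, hf₀⟩ => hs.exists_tendstoUniformlyOn hT0 hC hQs hQp hα hδ hη hδη hk.tendsto_atTop h1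
      hX₀ hY₀ h3 h4 hf₀⟩
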